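/- Let $(M,g)$ be a spacetime, i.e. a connected, Hausdorff, second countable smooth manifold with a smooth Lorentzian metric $g$ of signature $(-,+,\dots,+)$ and a time orientation. Causal (timelike) curves are piecewise $C^1$ curves, defined on intervals, with causal, nonzero (timelike) velocity. A future-directed causal curve is past-inextendible (future-inextendible) if it has no limit point at its past (future) end, and inextendible if both hold. Let $\operatorname{vol}_g$ be the volume measure of $g$ (given by $\sqrt{|\det g_{ij}|}\,dx$ in each chart), let $I^-(x)$ be the chronological past of $x$, and let $$\tau(x) := \operatorname{vol}_g(I^-(x)) \in [0,\infty]$$ be the cosmological volume function. It is called regular if $\tau(x)<\infty$ for all $x\in M$ and $\tau\to 0$ (towards the past) along every past-inextendible causal curve. A time function is a continuous function $M\to\mathbb{R}$ that is strictly increasing along every future-directed causal curve. A set $A\subseteq M$ is acausal if no causal curve joins two (possibly equal) points of $A$. Its edge is the set of those $p\in\overline{A}$ such that every neighbourhood $U$ of $p$ contains points $x\in I^-(p,U)$ and $y\in I^+(p,U)$ that are joined by a timelike curve in $U$ that does not meet $A$. The future domain of dependence $D^+(A)$ is the set of all $x\in M$ such that every past-inextendible causal curve starting at $x$ meets $A$,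 and $J^+(A)$ is the causal future of $A$ (which contains $A$). The set $A$ is a future Cauchy surface if it is closed, acausal, has empty edge, and $D^+(A)=J^+(A)$. It is a Cauchy surface if every inextendible causal curve meets it exactly once. Theorem. Suppose that the cosmological volume function $\tau$ of $(M,g)$ is regular. Then: 1. $\tau$ is a time function. 2. For every $0<t<\infty$, the level set $S_t:=\{x\in M \mid \tau(x)=t\}$ is a future Cauchy surface. 3. If moreover $\operatorname{vol}_g(I^-(\gamma(s)))\to\infty$, as $s$ tends to the future end, along every inextendible future-directed causal curve $\gamma$, then for every $0<t<\infty$ the level set $S_t$ is a Cauchy surface. -/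

import Mathlib

open Set Filter Topology MeasureTheory
open scoped Manifold ContDiff ENNReal

noncomputable section

/-- A (smooth, time-oriented) spacetime structure of dimension `d` on the manifold `M`: a smooth
symmetric `(0,2)`-tensor field `metric` of Lorentzian signature `(-, +, …, +)`, together with a
smooth timelike vector field `timeDir`, which fixes the time orientation. The signature condition
says that some vector `v` is timelike and that `metric` is positive definite on its orthogonal
complement. -/
structure Spacetime (d : ℕ) (M : Type*) [TopologicalSpace M]
    [ChartedSpace (EuclideanSpace ℝ (Fin d)) M] [IsManifold (𝓡 d) ∞ M] where
  /-- the metric tensor -/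
  metric : ∀ p : M, TangentSpace (𝓡 d) p →L[ℝ] TangentSpace (𝓡 d) p →L[ℝ] ℝ
  metric_symm : ∀ (p : M) (v w : TangentSpace (𝓡 d) p), metric p v w = metric p w v
  metric_signature : ∀ p : M, ∃ v : TangentSpace (𝓡 d) p, metric p v v < 0 ∧
    ∀ w : TangentSpace (𝓡 d) p, metric p v w = 0 → w ≠ 0 → 0 < metric p w w
  metric_smooth : ContMDiff (𝓡 d)
    ((𝓡 d).prod 𝓘(ℝ, EuclideanSpace ℝ (Fin d) →L[ℝ] EuclideanSpace ℝ (Fin d) →L[ℝ] ℝ)) ∞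
    (fun p : M ↦ Bundle.TotalSpace.mk'
      (EuclideanSpace ℝ (Fin d) →L[ℝ] EuclideanSpace ℝ (Fin d) →L[ℝ] ℝ)
      (E := fun p : M ↦ TangentSpace (𝓡 d) p →L[ℝ] TangentSpace (𝓡 d) p →L[ℝ] ℝ)
      p (metric p))
  /-- the future-directed timelike vector field that gives the time orientation -/
  timeDir : ∀ p : M, TangentSpace (𝓡 d) p
  timeDir_timelike : ∀ p : M, metric p (timeDir p) (timeDir p) < 0
  timeDir_smooth : ContMDiff (𝓡 d) ((𝓡 d).prod 𝓘(ℝ, EuclideanSpace ℝ (Fin d))) ∞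
    (fun p : M ↦ Bundle.TotalSpace.mk' (EuclideanSpace ℝ (Fin d))
      (E := fun p : M ↦ TangentSpace (𝓡 d) p) p (timeDir p))

namespace Spacetime

variable {d : ℕ} {M : Type*} [TopologicalSpace M]
  [ChartedSpace (EuclideanSpace ℝ (Fin d)) M] [IsManifold (𝓡 d) ∞ M]

/-! ### Causal curves -/

/-- Future-directed causal tangent vectors (nonzero, timelike or null). -/
def FutureCausal (S : Spacetime d M) (p : M) (v : TangentSpace (𝓡 d) p) : Prop :=
  v ≠ 0 ∧ S.metric p v v ≤ 0 ∧ S.metric p (S.timeDir p) v < 0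

/-- Future-directed timelike tangent vectors. -/
def FutureTimelike (S : Spacetime d M) (p : M) (v : TangentSpace (𝓡 d) p) : Prop :=
  S.metric p v v < 0 ∧ S.metric p (S.timeDir p) v < 0

/-- `γ` is `C¹` on the compact interval `[a, b]` (up to the end points, with one-sided derivatives
there), and its velocity satisfies `P` at each of its points. -/
def IsArc (P : ∀ p : M, TangentSpace (𝓡 d) p → Prop) (γ : ℝ → M) (a b : ℝ) : Prop :=
  ContMDiffOn 𝓘(ℝ, ℝ) (𝓡 d) 1 γ (Icc a b) ∧
    ∀ t ∈ Icc a b, P (γ t) (mfderivWithin 𝓘(ℝ, ℝ) (𝓡 d) γ (Icc a b) t (1 : ℝ))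

/-- `γ`, restricted to the nondegenerate interval `s` (which may be open, closed, half-open,
bounded or not), is a piecewise `C¹` curve whose velocity satisfies `P` (for both one-sided
velocities at a break point): each compact `[a, b] ⊆ s` has a finite partition
`a = c 0 < c 1 < ⋯ < c n = b` such that `γ` is an arc on each `[c i, c (i + 1)]`. -/
def IsPiecewiseCurve (P : ∀ p : M, TangentSpace (𝓡 d) p → Prop) (γ : ℝ → M) (s : Set ℝ) : Prop :=
  s.OrdConnected ∧ s.Nontrivial ∧ ∀ a ∈ s, ∀ b ∈ s, a < b →
    ∃ (n : ℕ) (c : ℕ → ℝ), c 0 = a ∧ c n = b ∧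
      ∀ i < n, c i < c (i + 1) ∧ IsArc P γ (c i) (c (i + 1))

/-- `γ : s → M` is a future-directed causal curve. -/
def IsCausalCurve (S : Spacetime d M) (γ : ℝ → M) (s : Set ℝ) : Prop :=
  IsPiecewiseCurve S.FutureCausal γ s

/-- `γ : s → M` is a future-directed timelike curve. -/
def IsTimelikeCurve (S : Spacetime d M) (γ : ℝ → M) (s : Set ℝ) : Prop :=
  IsPiecewiseCurve S.FutureTimelike γ s

/-- The curve `γ : s → M` has no past end point: `γ t` has no limit in `M` as `t ∈ s` decreases
to the lower end of `s`. (If `s` has a least element `a`, then `γ a` is such a limit.) -/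
def PastInextendible (γ : ℝ → M) (s : Set ℝ) : Prop :=
  ¬ ∃ p : M, Tendsto (fun t : s ↦ γ t) atBot (𝓝 p)

/-- The curve `γ : s → M` has no future end point. -/
def FutureInextendible (γ : ℝ → M) (s : Set ℝ) : Prop :=
  ¬ ∃ p : M, Tendsto (fun t : s ↦ γ t) atTop (𝓝 p)

/-- The curve `γ : s → M` is inextendible (to the past and to the future). -/
def Inextendible (γ : ℝ → M) (s : Set ℝ) : Prop :=
  PastInextendible γ s ∧ FutureInextendible γ s

/-- `x ≪ y` inside `U`: a future-directed timelike curve in `U` leads from `x` to `y`. -/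
def ChronologicalIn (S : Spacetime d M) (U : Set M) (x y : M) : Prop :=
  ∃ (γ : ℝ → M) (a b : ℝ), a < b ∧ S.IsTimelikeCurve γ (Icc a b) ∧ γ a = x ∧ γ b = y ∧
    ∀ t ∈ Icc a b, γ t ∈ U

/-- `x < y`: a future-directed (hence nonconstant) causal curve leads from `x` to `y`. -/
def StrictlyCausal (S : Spacetime d M) (x y : M) : Prop :=
  ∃ (γ : ℝ → M) (a b : ℝ), a < b ∧ S.IsCausalCurve γ (Icc a b) ∧ γ a = x ∧ γ b = y

/-- The chronological past `I⁻(x)`. -/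
def chronologicalPast (S : Spacetime d M) (x : M) : Set M :=
  {y | S.ChronologicalIn univ y x}

/-- The causal future `J⁺(A)`, which contains `A`. -/
def causalFuture (S : Spacetime d M) (A : Set M) : Set M :=
  {y | ∃ x ∈ A, x = y ∨ S.StrictlyCausal x y}

/-- The future domain of dependence `D⁺(A)`: the points `x` such that every past-inextendible
causal curve that starts at `x` (and runs to the past) meets `A`. Curves are parametrized towards
the future here, so `x` is the value at the greatest parameter. -/
def futureDomain (S : Spacetime d M) (A : Set M) : Set M :=
  {x | ∀ (γ : ℝ → M) (s : Set ℝ) (b : ℝ), S.IsCausalCurve γ s → PastInextendible γ s →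
    IsGreatest s b → γ b = x → ∃ t ∈ s, γ t ∈ A}

/-- The edge of `A`: the points `p` of its closure such that each neighbourhood `U` of `p` contains
points `x ∈ I⁻(p, U)` and `y ∈ I⁺(p, U)` and a timelike curve in `U` from `x` to `y` that avoids
`A`. -/
def edge (S : Spacetime d M) (A : Set M) : Set M :=
  {p ∈ closure A | ∀ U ∈ 𝓝 p, ∃ x y : M, S.ChronologicalIn U x p ∧ S.ChronologicalIn U p y ∧
    S.ChronologicalIn (U \ A) x y}

/-- No causal curve meets `A` twice. -/
def Acausal (S : Spacetime d M) (A : Set M) : Prop :=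
  ∀ x ∈ A, ∀ y ∈ A, ¬ S.StrictlyCausal x y

/-- A future Cauchy surface: closed, acausal and edgeless, with `D⁺(A) = J⁺(A)`. -/
structure IsFutureCauchySurface (S : Spacetime d M) (A : Set M) : Prop where
  isClosed : IsClosed A
  acausal : S.Acausal A
  edge_eq_empty : S.edge A = ∅
  futureDomain_eq : S.futureDomain A = S.causalFuture A

/-- A Cauchy surface: every inextendible causal curve meets it exactly once. -/
def IsCauchySurface (S : Spacetime d M) (A : Set M) : Prop :=
  ∀ (γ : ℝ → M) (s : Set ℝ), S.IsCausalCurve γ s → Inextendible γ s → ∃! t, t ∈ s ∧ γ t ∈ A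

/-- A time function: continuous and strictly increasing along future-directed causal curves. -/
def IsTimeFunction (S : Spacetime d M) (f : M → ℝ) : Prop :=
  Continuous f ∧ ∀ (γ : ℝ → M) (s : Set ℝ), S.IsCausalCurve γ s → StrictMonoOn (f ∘ γ) s

/-! ### The volume measure -/

/-- The density `√|det (g_ij)|` in the chart `e`, as a function on the chart's target, where
`g_ij = g (∂_i, ∂_j)` for the coordinate vectors `∂_i` of `e`. -/
def chartDensity (S : Spacetime d M) (e : OpenPartialHomeomorph M (EuclideanSpace ℝ (Fin d)))
    (y : EuclideanSpace ℝ (Fin d)) : ℝ≥0∞ :=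
  ENNReal.ofReal (Real.sqrt |(Matrix.of fun i j : Fin d ↦
    S.metric (e.symm y)
      (mfderiv (𝓡 d) (𝓡 d) e.symm y (EuclideanSpace.single i (1 : ℝ)))
      (mfderiv (𝓡 d) (𝓡 d) e.symm y (EuclideanSpace.single j (1 : ℝ)))).det|)

/-! The facts that follow, up to the definition of `chartVolume`, are change-of-variables lemmas
for the density; `volumeMeasure_apply` below uses them to show that the volume measure is
`√|det (g_ij)| dx` on the domain of each chart. -/

lemma mdiff_symm {e : OpenPartialHomeomorph M (EuclideanSpace ℝ (Fin d))}
    (he : e ∈ atlas (EuclideanSpace ℝ (Fin d)) M) {y} (hy : y ∈ e.target) :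
    MDifferentiableAt (𝓡 d) (𝓡 d) e.symm y := by
  have := contMDiffOn_symm_of_mem_maximalAtlas (I := 𝓡 d) (n := ∞) (IsManifold.subset_maximalAtlas he)
  exact (this.contMDiffAt (e.open_target.mem_nhds hy)).mdifferentiableAt (by simp)

lemma mdiff_fwd {e : OpenPartialHomeomorph M (EuclideanSpace ℝ (Fin d))}
    (he : e ∈ atlas (EuclideanSpace ℝ (Fin d)) M) {y} (hy : y ∈ e.source) :
    MDifferentiableAt (𝓡 d) (𝓡 d) e y := by
  have := contMDiffOn_of_mem_maximalAtlas (I := 𝓡 d) (n := ∞) (IsManifold.subset_maximalAtlas he)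
  exact (this.contMDiffAt (e.open_source.mem_nhds hy)).mdifferentiableAt (by simp)

lemma det_pull (B : EuclideanSpace ℝ (Fin d) →L[ℝ] EuclideanSpace ℝ (Fin d) →L[ℝ] ℝ)
    (L : EuclideanSpace ℝ (Fin d) →L[ℝ] EuclideanSpace ℝ (Fin d)) 
    (L' : EuclideanSpace ℝ (Fin d) →L[ℝ] EuclideanSpace ℝ (Fin d)) :
   (Matrix.of fun i j : Fin d ↦ B (L' (L (EuclideanSpace.single i (1 : ℝ)))) (L' (L (EuclideanSpace.single j 1)))).det
    = L.det ^ 2 * (Matrix.of fun i j : Fin d ↦ B (L' (EuclideanSpace.single i (1 : ℝ))) (L' (EuclideanSpace.single j 1))).det := by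
  let b := (EuclideanSpace.basisFun (Fin d) ℝ).toBasis
  let J := LinearMap.toMatrix b b (L : EuclideanSpace ℝ (Fin d) →ₗ[ℝ] EuclideanSpace ℝ (Fin d))
  have hJ : J.det = L.det := by
    simp only [J, LinearMap.det_toMatrix]
  have hL : ∀ j, L (EuclideanSpace.single j 1) = ∑ k, J k j • EuclideanSpace.single k (1:ℝ) := by
    intro j
    have := b.sum_repr (L (EuclideanSpace.single j 1))
    rw [← this]
    refine Finset.sum_congr rfl fun k _ => ?_
    simp [J, LinearMap.toMatrix_apply, b]
  have : (Matrix.of fun i j : Fin d ↦ B (L' (L (EuclideanSpace.single i (1 : ℝ)))) (L' (L (EuclideanSpace.single j 1))))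
    = J.transpose * (Matrix.of fun i j : Fin d ↦ B (L' (EuclideanSpace.single i (1 : ℝ))) (L' (EuclideanSpace.single j 1))) * J := by
    ext i j
    simp only [Matrix.of_apply, hL, map_sum, map_smul, sum_apply, smul_apply,
      Matrix.mul_apply, Matrix.transpose_apply, smul_eq_mul, Finset.sum_mul, Finset.mul_sum]
    refine Finset.sum_congr rfl fun k _ => Finset.sum_congr rfl fun l _ => ?_; ring
  rw [this, Matrix.det_mul, Matrix.det_mul, Matrix.det_transpose, hJ]; ring

lemma density_change (S : Spacetime d M) {e e' : OpenPartialHomeomorph M (EuclideanSpace ℝ (Fin d))}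
    (he : e ∈ atlas (EuclideanSpace ℝ (Fin d)) M) (he' : e' ∈ atlas (EuclideanSpace ℝ (Fin d)) M)
    {y} (hy : y ∈ e.target) (hy' : e.symm y ∈ e'.source) :
    S.chartDensity e y = ENNReal.ofReal |(fderiv ℝ (e' ∘ e.symm) y).det| * S.chartDensity e' (e' (e.symm y)) := by
  have h1 : mfderiv (𝓡 d) (𝓡 d) (e' ∘ e.symm) y = (mfderiv (𝓡 d) (𝓡 d) e' (e.symm y)).comp (mfderiv (𝓡 d) (𝓡 d) e.symm y) :=
    mfderiv_comp y (mdiff_fwd he' hy') (mdiff_symm he hy)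
  have hd : MDifferentiableAt (𝓡 d) (𝓡 d) (e' ∘ e.symm) y := (mdiff_fwd he' hy').comp y (mdiff_symm he hy)
  have hev : e.symm =ᶠ[𝓝 y] e'.symm ∘ (e' ∘ e.symm) := by
    have : ∀ᶠ z in 𝓝 y, e.symm z ∈ e'.source := 
      (e.continuousAt_symm hy).eventually (e'.open_source.mem_nhds hy')
    filter_upwards [this] with z hz
    simp [e'.left_inv hz]
  have h2 : mfderiv (𝓡 d) (𝓡 d) e.symm y = (mfderiv (𝓡 d) (𝓡 d) e'.symm (e' (e.symm y))).comp
     (mfderiv (𝓡 d) (𝓡 d) (e' ∘ e.symm) y) := by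
    rw [hev.mfderiv_eq]
    exact mfderiv_comp y (mdiff_symm he' (e'.map_source hy')) hd
  have h3 : e'.symm (e' (e.symm y)) = e.symm y := e'.left_inv hy'
  rw [mfderiv_eq_fderiv] at h2
  unfold chartDensity
  have key := det_pull (S.metric (e.symm y)) (fderiv ℝ (e' ∘ e.symm) y) (mfderiv (𝓡 d) (𝓡 d) e'.symm (e' (e.symm y)))
  rw [← ENNReal.ofReal_mul (abs_nonneg _)]
  congr 1
  have e1 : ∀ i, mfderiv (𝓡 d) (𝓡 d) e.symm y (EuclideanSpace.single i (1:ℝ)) = 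
    mfderiv (𝓡 d) (𝓡 d) e'.symm (e' (e.symm y)) (fderiv ℝ (e' ∘ e.symm) y (EuclideanSpace.single i (1:ℝ))) := by
    intro i; rw [h2]; rfl
  have e2 : ∀ v w : EuclideanSpace ℝ (Fin d), S.metric (e'.symm (e' (e.symm y))) v w = S.metric (e.symm y) v w := by
    intro v w
    have : ∀ p q : M, p = q → ∀ v w : EuclideanSpace ℝ (Fin d), S.metric p v w = S.metric q v w := by
      rintro p _ rfl v w; rfl
    exact this _ _ h3 v w
  simp only [e1]
  erw [key]
  rw [abs_mul, abs_pow, Real.sqrt_mul (by positivity), Real.sqrt_sq (abs_nonneg _)]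
  congr 4
  ext i j
  exact (e2 _ _).symm

variable [MeasurableSpace M]

/-- The measure `√|det (g_ij)| dx` of the chart `e`, as a measure on `M` carried by the domain
of `e`. -/
def chartVolume (S : Spacetime d M) (e : OpenPartialHomeomorph M (EuclideanSpace ℝ (Fin d))) :
    Measure M :=
  ((volume.restrict e.target).withDensity (S.chartDensity e)).map e.symm

/-- The volume measure `vol_g` of the spacetime. The measures `√|det (g_ij)| dx` of any two charts
agree on the overlap of their domains, so the least measure above all of them is the measure which
restricts to `√|det (g_ij)| dx` on the domain of each chart (`volumeMeasure_apply`). -/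
def volumeMeasure (S : Spacetime d M) : Measure M :=
  ⨆ e ∈ atlas (EuclideanSpace ℝ (Fin d)) M, S.chartVolume e

section WellDefined

variable [BorelSpace M]

lemma chartVolume_apply (S : Spacetime d M) (e : OpenPartialHomeomorph M (EuclideanSpace ℝ (Fin d))) {A : Set M} (hA : MeasurableSet A) :
   S.chartVolume e A = ∫⁻ y in e.symm ⁻¹' A ∩ e.target, S.chartDensity e y ∧ MeasurableSet (e.symm ⁻¹' A ∩ e.target) := by
  have hm : Measurable (e.target.domRestrict e.symm) := (e.continuousOn_symm.domRestrict).measurable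
  have hms : MeasurableSet (e.symm ⁻¹' A ∩ e.target) := by
    have := e.open_target.measurableSet.subtype_image (hm hA)
    convert this using 1
    ext y; simp [and_comm, Set.domRestrict]
  have ham : AEMeasurable e.symm (volume.restrict e.target) := e.continuousOn_symm.aemeasurable e.open_target.measurableSet
  have ham' : AEMeasurable e.symm ((volume.restrict e.target).withDensity (S.chartDensity e)) :=
    ham.mono_ac (withDensity_absolutelyContinuous _ _)
  refine ⟨?_, hms⟩
  have hn : NullMeasurableSet (e.symm ⁻¹' A) ((volume.restrict e.target)) := ham.nullMeasurableSet_preimage hA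
  have hsupp : ∀ ν : Measure (EuclideanSpace ℝ (Fin d)), ν ≪ volume.restrict e.target → ν (e.symm ⁻¹' A) = ν (e.symm ⁻¹' A ∩ e.target) := by
    intro ν hν
    refine (measure_inter_conull ?_).symm
    apply hν
    rw [Measure.restrict_apply e.open_target.measurableSet.compl]; simp
  rw [chartVolume, Measure.map_apply_of_aemeasurable ham' hA, hsupp _ (withDensity_absolutelyContinuous _ _), withDensity_apply _ hms,
    Measure.restrict_restrict hms, inter_assoc, inter_self]

lemma chartVolume_eq (S : Spacetime d M) {e e' : OpenPartialHomeomorph M (EuclideanSpace ℝ (Fin d))}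
    (he : e ∈ atlas (EuclideanSpace ℝ (Fin d)) M) (he' : e' ∈ atlas (EuclideanSpace ℝ (Fin d)) M)
    {A : Set M} (hA : MeasurableSet A) (h : A ⊆ e.source) (h' : A ⊆ e'.source) :
    S.chartVolume e A = S.chartVolume e' A := by
  obtain ⟨h1, m1⟩ := S.chartVolume_apply e hA
  obtain ⟨h2, m2⟩ := S.chartVolume_apply e' hA
  rw [h1, h2]
  have himg : e'.symm ⁻¹' A ∩ e'.target = (e' ∘ e.symm) '' (e.symm ⁻¹' A ∩ e.target) := by
    ext z; constructor
    · rintro ⟨hz, hz'⟩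
      refine ⟨e (e'.symm z), ⟨?_, e.map_source (h hz)⟩, ?_⟩
      · simpa [e.left_inv (h hz)] using hz
      · simp [e.left_inv (h hz), e'.right_inv hz']
    · rintro ⟨y, ⟨hy, hy'⟩, rfl⟩
      refine ⟨?_, e'.map_source (h' hy)⟩
      simpa [e'.left_inv (h' hy)] using hy
  rw [himg, lintegral_image_eq_lintegral_abs_det_fderiv_mul volume m1 (f' := fun y => fderiv ℝ (e' ∘ e.symm) y)]
  · refine setLIntegral_congr_fun m1 fun y hy => ?_
    exact S.density_change he he' hy.2 (h' hy.1)
  · intro y hy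
    have hd : MDifferentiableAt (𝓡 d) (𝓡 d) (e' ∘ e.symm) y := (mdiff_fwd he' (h' hy.1)).comp y (mdiff_symm he hy.2)
    exact (mdifferentiableAt_iff_differentiableAt.1 hd).hasFDerivAt.hasFDerivWithinAt
  · intro y hy z hz hyz
    have := e'.injOn (h' hy.1) (h' hz.1) hyz
    exact e.symm.injOn hy.2 hz.2 this

/-- On the domain of each chart the volume measure is `√|det (g_ij)| dx`. -/
theorem volumeMeasure_apply (S : Spacetime d M) {e : OpenPartialHomeomorph M (EuclideanSpace ℝ (Fin d))}
    (he : e ∈ atlas (EuclideanSpace ℝ (Fin d)) M) 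
    {A : Set M} (hA : MeasurableSet A) (h : A ⊆ e.source) :
    S.volumeMeasure A = S.chartVolume e A := by
  apply le_antisymm
  · have : S.volumeMeasure ≤ S.chartVolume e + S.volumeMeasure.restrict e.sourceᶜ := by
      refine iSup₂_le fun e' he' => Measure.le_iff.2 fun B hB => ?_
      have hs := e.open_source.measurableSet
      have hs' := e'.open_source.measurableSet
      have hz : S.chartVolume e' e'.sourceᶜ = 0 := by
        rw [(S.chartVolume_apply e' hs'.compl).1]
        have : e'.symm ⁻¹' e'.sourceᶜ ∩ e'.target = ∅ := by
          ext y; simp only [mem_inter_iff, mem_preimage, mem_compl_iff, mem_empty_iff_false, iff_false]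
          exact fun hy => hy.1 (e'.map_target hy.2)
        rw [this]; simp
      rw [← measure_inter_add_sdiff B hs, Measure.add_apply]
      refine add_le_add ?_ ?_
      · rw [← measure_inter_conull hz, S.chartVolume_eq he' he ((hB.inter hs).inter hs') inter_subset_right
          (inter_subset_left.trans inter_subset_right)]
        exact measure_mono (inter_subset_left.trans inter_subset_left)
      · rw [Measure.restrict_apply hB, sdiff_eq]
        exact (le_iSup₂ (f := fun e (_ : e ∈ atlas (EuclideanSpace ℝ (Fin d)) M) => S.chartVolume e) e' he') _
    refine (this A).trans ?_
    rw [Measure.add_apply, Measure.restrict_apply hA]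
    have : A ∩ e.sourceᶜ = ∅ := by rw [← sdiff_eq, sdiff_eq_empty]; exact h
    simp [this]
  · exact (le_iSup₂ (f := fun e (_ : e ∈ atlas (EuclideanSpace ℝ (Fin d)) M) => S.chartVolume e) e he) A

end WellDefined

/-- The cosmological volume function `τ(x) = vol_g(I⁻(x))`. -/
def cosmologicalVolume (S : Spacetime d M) (x : M) : ℝ≥0∞ :=
  S.volumeMeasure (S.chronologicalPast x)

/-- The cosmological volume function is regular: it is finite, and it tends to `0` (towards the
past) along every past-inextendible causal curve. -/
structure HasRegularCosmologicalVolume (S : Spacetime d M) : Prop where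
  finite : ∀ x : M, S.cosmologicalVolume x < ⊤
  tendsto_zero : ∀ (γ : ℝ → M) (s : Set ℝ), S.IsCausalCurve γ s → PastInextendible γ s →
    Tendsto (fun t : s ↦ S.cosmologicalVolume (γ t)) atBot (𝓝 0)

end Spacetime

end

/-! Globally, the proof works with the order `CausalLE`: `x ≤ y` when `I⁻(x) ⊆ I⁻(y)` and `I⁺(y) ⊆
I⁺(x)`. Causal curves imply it (`PiecewiseArc.causalLE`, the push-up property), and in small
coordinate balls so do limits of causal curves (`exists_coordBall_causalLE`), because shearing a
causal curve slightly in the time direction makes it timelike.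

Regularity enters mainly through `exists_tendsto`. Take a decreasing sequence and a point `a` that
precedes everything in the chronological futures of its terms. If the sequence had no limit, it
could be shadowed by a past-inextendible timelike curve whose pasts all contain `I⁻(a)`. As `I⁻(a)`
has positive volume, `τ` would not tend to `0`. Hence `≤` is antisymmetric (`causalLE_antisymm`),
and limits of chronologically related pairs are `≤`-related (`causalLE_of_mem_closure`). The latter
is a limit curve argument carried out with a sequence of points instead of a limit curve.

The rest is measure theory. Open sets have positive volume, so `τ(x) = τ(y)` with `x < y` would make
`I⁻(x)` dense in `I⁻(y)`, hence `y ≤ x` and `x = y`, a closed causal curve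
(`cosmologicalVolume_lt`). Achronal measurable sets are null, which excludes upward jumps of `τ`;
downward jumps are excluded by openness of chronology (`continuous_cosmologicalVolume`). The level
sets of a time function are closed, acausal and edgeless, and the limits of `τ` along curves
together with the intermediate value theorem give the Cauchy properties. -/

noncomputable section

namespace Spacetime

/-! ### Metric and time orientation in chart coordinates -/

section Coordinates

variable {d : ℕ} {M : Type*} [TopologicalSpace M]
  [ChartedSpace (EuclideanSpace ℝ (Fin d)) M] [IsManifold (𝓡 d) ∞ M]

/-- The differential of the inverse of the chart `e`, as a linear map from the model space. -/
def coordFrame (e : OpenPartialHomeomorph M (EuclideanSpace ℝ (Fin d)))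
    (y : EuclideanSpace ℝ (Fin d)) :
    EuclideanSpace ℝ (Fin d) →L[ℝ] EuclideanSpace ℝ (Fin d) :=
  mfderiv (𝓡 d) (𝓡 d) e.symm y

/-- The metric at `p` as a bilinear form on the model space. -/
def metricForm (S : Spacetime d M) (p : M) :
    EuclideanSpace ℝ (Fin d) →L[ℝ] EuclideanSpace ℝ (Fin d) →L[ℝ] ℝ := S.metric p

/-- The time direction at `p` as a vector of the model space. -/
def timeVec (S : Spacetime d M) (p : M) : EuclideanSpace ℝ (Fin d) := S.timeDir p

/-- The metric in the coordinates of the chart `e`. -/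
def coordMetric (S : Spacetime d M) (e : OpenPartialHomeomorph M (EuclideanSpace ℝ (Fin d)))
    (y : EuclideanSpace ℝ (Fin d)) :
    EuclideanSpace ℝ (Fin d) →L[ℝ] EuclideanSpace ℝ (Fin d) →L[ℝ] ℝ :=
  (S.metricForm (e.symm y)).bilinearComp (coordFrame e y) (coordFrame e y)

/-- The covector `g (timeDir, ·)` in the coordinates of the chart `e`. -/
def coordTime (S : Spacetime d M) (e : OpenPartialHomeomorph M (EuclideanSpace ℝ (Fin d)))
    (y : EuclideanSpace ℝ (Fin d)) : EuclideanSpace ℝ (Fin d) →L[ℝ] ℝ :=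
  (S.metricForm (e.symm y) (S.timeVec (e.symm y))).comp (coordFrame e y)

lemma coordMetric_apply (S : Spacetime d M)
    (e : OpenPartialHomeomorph M (EuclideanSpace ℝ (Fin d))) (y v w : EuclideanSpace ℝ (Fin d)) :
    S.coordMetric e y v w = S.metricForm (e.symm y) (coordFrame e y v) (coordFrame e y w) := rfl

lemma coordTime_apply (S : Spacetime d M)
    (e : OpenPartialHomeomorph M (EuclideanSpace ℝ (Fin d))) (y v : EuclideanSpace ℝ (Fin d)) :
    S.coordTime e y v = S.metricForm (e.symm y) (S.timeVec (e.symm y)) (coordFrame e y v) := rfl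

/-- Smoothness of the coordinate vector fields as sections of the tangent bundle is what turns
smoothness of the bundle tensors into smoothness of their components. -/
lemma contMDiffAt_coordFrame_apply {e : OpenPartialHomeomorph M (EuclideanSpace ℝ (Fin d))}
    (he : e ∈ atlas (EuclideanSpace ℝ (Fin d)) M) {y : EuclideanSpace ℝ (Fin d)}
    (hy : y ∈ e.target) (v : EuclideanSpace ℝ (Fin d)) :
    ContMDiffAt 𝓘(ℝ, EuclideanSpace ℝ (Fin d)) ((𝓡 d).prod 𝓘(ℝ, EuclideanSpace ℝ (Fin d))) ∞
      (fun y ↦ Bundle.TotalSpace.mk' (EuclideanSpace ℝ (Fin d))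
        (E := fun p : M ↦ TangentSpace (𝓡 d) p) (e.symm y) (coordFrame e y v)) y := by
  have hs : ContMDiffAt (𝓡 d) (𝓡 d) ∞ e.symm y :=
    (contMDiffOn_symm_of_mem_maximalAtlas (I := 𝓡 d) (n := ∞)
      (IsManifold.subset_maximalAtlas he)).contMDiffAt (e.open_target.mem_nhds hy)
  have h1 : ContMDiffAt (𝓡 d) 𝓘(ℝ, EuclideanSpace ℝ (Fin d) →L[ℝ] EuclideanSpace ℝ (Fin d)) ∞
      (inTangentCoordinates (𝓡 d) (𝓡 d) id e.symm (mfderiv (𝓡 d) (𝓡 d) e.symm) y) y :=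
    hs.mfderiv_const (m := ∞) (by simp)
  have hv : ContMDiffAt (𝓡 d) ((𝓡 d).prod 𝓘(ℝ, EuclideanSpace ℝ (Fin d))) ∞
      (fun y : EuclideanSpace ℝ (Fin d) ↦ Bundle.TotalSpace.mk' (EuclideanSpace ℝ (Fin d))
        (E := fun p : EuclideanSpace ℝ (Fin d) ↦ TangentSpace (𝓡 d) p) y v) y :=
    contMDiffAt_vectorSpace_iff_contDiffAt.2 contDiffAt_const
  exact ContMDiffAt.clm_apply_of_inCoordinates (E₁ := fun p : EuclideanSpace ℝ (Fin d) ↦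
    TangentSpace (𝓡 d) p) (E₂ := fun p : M ↦ TangentSpace (𝓡 d) p) (b₁ := id) (b₂ := e.symm)
    (ϕ := fun y ↦ mfderiv (𝓡 d) (𝓡 d) e.symm y) (v := fun _ ↦ v) h1 hv hs

lemma contDiffAt_coordMetric (S : Spacetime d M)
    {e : OpenPartialHomeomorph M (EuclideanSpace ℝ (Fin d))}
    (he : e ∈ atlas (EuclideanSpace ℝ (Fin d)) M) {y : EuclideanSpace ℝ (Fin d)}
    (hy : y ∈ e.target) : ContDiffAt ℝ ∞ (S.coordMetric e) y := by
  have key : ∀ v w, ContDiffOn ℝ ∞ (fun y ↦ S.coordMetric e y v w) e.target := by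
    intro v w y hy
    have hs : ContMDiffAt (𝓡 d) (𝓡 d) ∞ e.symm y :=
      (contMDiffOn_symm_of_mem_maximalAtlas (I := 𝓡 d) (n := ∞)
        (IsManifold.subset_maximalAtlas he)).contMDiffAt (e.open_target.mem_nhds hy)
    have : ContMDiffAt 𝓘(ℝ, EuclideanSpace ℝ (Fin d)) ((𝓡 d).prod 𝓘(ℝ)) ∞
        (fun m ↦ Bundle.TotalSpace.mk' ℝ (E := Bundle.Trivial M ℝ) (e.symm m)
          (S.metric (e.symm m) (coordFrame e m v) (coordFrame e m w))) y := by
      apply ContMDiffAt.clm_bundle_apply₂ (F₁ := EuclideanSpace ℝ (Fin d))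
        (F₂ := EuclideanSpace ℝ (Fin d))
      · exact ContMDiffAt.comp y S.metric_smooth.contMDiffAt hs
      · exact contMDiffAt_coordFrame_apply he hy v
      · exact contMDiffAt_coordFrame_apply he hy w
    simp only [Bundle.contMDiffAt_totalSpace] at this
    exact (contMDiffAt_iff_contDiffAt.1 this.2).contDiffWithinAt
  have : ContDiffOn ℝ ∞ (S.coordMetric e) e.target :=
    contDiffOn_clm_apply.2 fun v ↦ contDiffOn_clm_apply.2 fun w ↦ key v w
  exact this.contDiffAt (e.open_target.mem_nhds hy)

lemma continuousAt_coordTime (S : Spacetime d M)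
    {e : OpenPartialHomeomorph M (EuclideanSpace ℝ (Fin d))}
    (he : e ∈ atlas (EuclideanSpace ℝ (Fin d)) M) {y : EuclideanSpace ℝ (Fin d)}
    (hy : y ∈ e.target) : ContinuousAt (S.coordTime e) y := by
  have key : ∀ v, ContDiffOn ℝ ∞ (fun y ↦ S.coordTime e y v) e.target := by
    intro v y hy
    have hs : ContMDiffAt (𝓡 d) (𝓡 d) ∞ e.symm y :=
      (contMDiffOn_symm_of_mem_maximalAtlas (I := 𝓡 d) (n := ∞)
        (IsManifold.subset_maximalAtlas he)).contMDiffAt (e.open_target.mem_nhds hy)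
    have : ContMDiffAt 𝓘(ℝ, EuclideanSpace ℝ (Fin d)) ((𝓡 d).prod 𝓘(ℝ)) ∞
        (fun m ↦ Bundle.TotalSpace.mk' ℝ (E := Bundle.Trivial M ℝ) (e.symm m)
          (S.metric (e.symm m) (S.timeDir (e.symm m)) (coordFrame e m v))) y := by
      apply ContMDiffAt.clm_bundle_apply₂ (F₁ := EuclideanSpace ℝ (Fin d))
        (F₂ := EuclideanSpace ℝ (Fin d))
      · exact ContMDiffAt.comp y S.metric_smooth.contMDiffAt hs
      · exact ContMDiffAt.comp y S.timeDir_smooth.contMDiffAt hs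
      · exact contMDiffAt_coordFrame_apply he hy v
    simp only [Bundle.contMDiffAt_totalSpace] at this
    exact (contMDiffAt_iff_contDiffAt.1 this.2).contDiffWithinAt
  have : ContDiffOn ℝ ∞ (S.coordTime e) e.target := contDiffOn_clm_apply.2 key
  exact this.continuousOn.continuousAt (e.open_target.mem_nhds hy)

/-- The coordinates of a tangent vector in the chart `e`. -/
def coordVec (e : OpenPartialHomeomorph M (EuclideanSpace ℝ (Fin d)))
    (y : EuclideanSpace ℝ (Fin d)) :
    EuclideanSpace ℝ (Fin d) →L[ℝ] EuclideanSpace ℝ (Fin d) :=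
  mfderiv (𝓡 d) (𝓡 d) e (e.symm y)

lemma coordVec_coordFrame {e : OpenPartialHomeomorph M (EuclideanSpace ℝ (Fin d))}
    (he : e ∈ atlas (EuclideanSpace ℝ (Fin d)) M) {y : EuclideanSpace ℝ (Fin d)}
    (hy : y ∈ e.target) (v : EuclideanSpace ℝ (Fin d)) :
    coordVec e y (coordFrame e y v) = v := by
  have h1 : mfderiv (𝓡 d) (𝓡 d) (e ∘ e.symm) y =
      (mfderiv (𝓡 d) (𝓡 d) e (e.symm y)).comp (mfderiv (𝓡 d) (𝓡 d) e.symm y) :=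
    mfderiv_comp y (mdiff_fwd he (e.map_target hy)) (mdiff_symm he hy)
  have h2 : (e ∘ e.symm) =ᶠ[𝓝 y] id := by
    filter_upwards [e.open_target.mem_nhds hy] with z hz using e.right_inv hz
  rw [h2.mfderiv_eq, mfderiv_id] at h1
  exact (congrArg (fun L ↦ L v) h1).symm

lemma coordFrame_coordVec {e : OpenPartialHomeomorph M (EuclideanSpace ℝ (Fin d))}
    (he : e ∈ atlas (EuclideanSpace ℝ (Fin d)) M) {y : EuclideanSpace ℝ (Fin d)}
    (hy : y ∈ e.target) (v : EuclideanSpace ℝ (Fin d)) :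
    coordFrame e y (coordVec e y v) = v := by
  have hr : Function.LeftInverse (coordVec e y) (coordFrame e y) := coordVec_coordFrame he hy
  have hinj : Function.Injective
      (coordFrame e y : EuclideanSpace ℝ (Fin d) →ₗ[ℝ] EuclideanSpace ℝ (Fin d)) := hr.injective
  have hsurj := LinearMap.injective_iff_surjective.1 hinj
  obtain ⟨w, hw⟩ := hsurj v
  have hw' : coordFrame e y w = v := hw
  rw [← hw', hr w]

/-- The future causal vectors in the coordinates of the chart `e`. -/
lemma futureCausal_coordFrame (S : Spacetime d M)
    {e : OpenPartialHomeomorph M (EuclideanSpace ℝ (Fin d))}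
    (he : e ∈ atlas (EuclideanSpace ℝ (Fin d)) M) {y : EuclideanSpace ℝ (Fin d)}
    (hy : y ∈ e.target) (v : EuclideanSpace ℝ (Fin d)) :
    S.FutureCausal (e.symm y) (coordFrame e y v) ↔
      v ≠ 0 ∧ S.coordMetric e y v v ≤ 0 ∧ S.coordTime e y v < 0 := by
  have hr : Function.LeftInverse (coordVec e y) (coordFrame e y) := coordVec_coordFrame he hy
  have h0 : coordFrame e y v = 0 ↔ v = 0 :=
    ⟨fun h ↦ hr.injective (h.trans (map_zero (coordFrame e y)).symm),
      fun h ↦ h ▸ map_zero (coordFrame e y)⟩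
  exact and_congr (not_congr h0) Iff.rfl

end Coordinates

/-! ### Piecewise curves as concatenations of arcs -/

section Curves

variable {d : ℕ} {M : Type*} [TopologicalSpace M]
  [ChartedSpace (EuclideanSpace ℝ (Fin d)) M]
  {P Q : ∀ p : M, TangentSpace (𝓡 d) p → Prop} {γ γ' : ℝ → M} {a b c : ℝ}

lemma IsArc.congr (h : IsArc P γ a b) (hγ : EqOn γ' γ (Icc a b)) : IsArc P γ' a b := by
  refine ⟨h.1.congr hγ, fun t ht ↦ ?_⟩
  have h1 := h.2 t ht
  rw [mfderivWithin_congr hγ (hγ ht)]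
  rw [hγ ht]
  exact h1

lemma IsArc.mono (h : IsArc P γ a b) {a' b' : ℝ} (ha : a ≤ a') (hab : a' < b') (hb : b' ≤ b) :
    IsArc P γ a' b' := by
  have hss : Icc a' b' ⊆ Icc a b := Icc_subset_Icc ha hb
  refine ⟨h.1.mono hss, fun t ht ↦ ?_⟩
  have h1 := h.2 t (hss ht)
  have hu : UniqueMDiffWithinAt 𝓘(ℝ, ℝ) (Icc a' b') t :=
    (uniqueDiffOn_Icc hab t ht).uniqueMDiffWithinAt
  rw [mfderivWithin_subset hss hu ((h.1.mdifferentiableOn (by simp)) t (hss ht))]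
  exact h1

lemma IsArc.imp (h : IsArc P γ a b) (hPQ : ∀ p v, P p v → Q p v) : IsArc Q γ a b :=
  ⟨h.1, fun t ht ↦ hPQ _ _ (h.2 t ht)⟩

lemma IsArc.comp_affine (h : IsArc P γ a b) (hab : a < b)
    (hP : ∀ p v (k : ℝ), 0 < k → P p v → P p (k • v)) {k m a' b' : ℝ} (hk : 0 < k)
    (ha : k * a' + m = a) (hb : k * b' + m = b) : IsArc P (fun t ↦ γ (k * t + m)) a' b' := by
  have hab' : a' < b' := by
    by_contra! hcon
    nlinarith
  have hmaps : MapsTo (fun t ↦ k * t + m) (Icc a' b') (Icc a b) := by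
    intro t ht
    constructor
    · rw [← ha]; nlinarith [ht.1]
    · rw [← hb]; nlinarith [ht.2]
  have hc : ContMDiff 𝓘(ℝ, ℝ) 𝓘(ℝ, ℝ) 1 (fun t : ℝ ↦ k * t + m) := by
    rw [contMDiff_iff_contDiff]; fun_prop
  refine ⟨h.1.comp hc.contMDiffOn hmaps, fun t ht ↦ ?_⟩
  have h1 := h.2 _ (hmaps ht)
  have hu : UniqueMDiffWithinAt 𝓘(ℝ, ℝ) (Icc a' b') t :=
    (uniqueDiffOn_Icc hab' t ht).uniqueMDiffWithinAt
  have h2 := mfderivWithin_comp (I := 𝓘(ℝ, ℝ)) (I' := 𝓘(ℝ, ℝ)) (I'' := 𝓡 d) t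
    (f := fun t : ℝ ↦ k * t + m) (g := γ) (h.1.mdifferentiableOn (by simp) _ (hmaps ht))
    (hc.contMDiffOn.mdifferentiableOn (by simp) t ht) hmaps hu
  have h3 : mfderivWithin 𝓘(ℝ, ℝ) 𝓘(ℝ, ℝ) (fun t : ℝ ↦ k * t + m) (Icc a' b') t (1 : ℝ) = k := by
    rw [mfderivWithin_eq_fderivWithin]
    have : HasDerivAt (fun t : ℝ ↦ k * t + m) k t := by
      simpa using ((hasDerivAt_id t).const_mul k).add_const m
    rw [this.hasFDerivAt.hasFDerivWithinAt.fderivWithin (uniqueDiffOn_Icc hab' t ht)]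
    exact one_smul ℝ k
  have h4 : mfderivWithin 𝓘(ℝ, ℝ) (𝓡 d) (fun t ↦ γ (k * t + m)) (Icc a' b') t (1 : ℝ)
      = k • mfderivWithin 𝓘(ℝ, ℝ) (𝓡 d) γ (Icc a b) (k * t + m) (1 : ℝ) := by
    have h5 : mfderivWithin 𝓘(ℝ, ℝ) (𝓡 d) (fun t ↦ γ (k * t + m)) (Icc a' b') t (1 : ℝ)
      = mfderivWithin 𝓘(ℝ, ℝ) (𝓡 d) γ (Icc a b) (k * t + m)
        (mfderivWithin 𝓘(ℝ, ℝ) 𝓘(ℝ, ℝ) (fun t : ℝ ↦ k * t + m) (Icc a' b') t (1 : ℝ)) :=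
      congrArg (fun L : ℝ →L[ℝ] EuclideanSpace ℝ (Fin d) ↦ L (1 : ℝ)) h2
    rw [h5, h3]
    have := (mfderivWithin 𝓘(ℝ, ℝ) (𝓡 d) γ (Icc a b) (k * t + m)).map_smul k (1 : ℝ)
    rw [← this]
    congr 1
    exact (mul_one k).symm
  rw [h4]
  exact hP _ _ k hk h1

/-- A curve made of finitely many arcs. -/
inductive PiecewiseArc (P : ∀ p : M, TangentSpace (𝓡 d) p → Prop) (γ : ℝ → M) : ℝ → ℝ → Prop
  | arc {a b : ℝ} : a < b → IsArc P γ a b → PiecewiseArc P γ a b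
  | trans {a b c : ℝ} : PiecewiseArc P γ a b → PiecewiseArc P γ b c → PiecewiseArc P γ a c

namespace PiecewiseArc

lemma lt (h : PiecewiseArc P γ a b) : a < b := by
  induction h with
  | arc h _ => exact h
  | trans _ _ h1 h2 => exact h1.trans h2

lemma congr (h : PiecewiseArc P γ a b) (hγ : EqOn γ' γ (Icc a b)) : PiecewiseArc P γ' a b := by
  induction h with
  | arc h h' => exact .arc h (h'.congr hγ)
  | trans h1 h2 ih1 ih2 =>
    exact .trans (ih1 (hγ.mono (Icc_subset_Icc_right h2.lt.le)))
      (ih2 (hγ.mono (Icc_subset_Icc_left h1.lt.le)))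

lemma imp (h : PiecewiseArc P γ a b) (hPQ : ∀ p v, P p v → Q p v) : PiecewiseArc Q γ a b := by
  induction h with
  | arc h h' => exact .arc h (h'.imp hPQ)
  | trans _ _ ih1 ih2 => exact .trans ih1 ih2

lemma mono (h : PiecewiseArc P γ a b) {a' b' : ℝ} (ha : a ≤ a') (hab : a' < b') (hb : b' ≤ b) :
    PiecewiseArc P γ a' b' := by
  induction h generalizing a' b' with
  | arc h h' => exact .arc hab (h'.mono ha hab hb)
  | @trans a b c h1 h2 ih1 ih2 =>
    rcases le_or_gt b' b with hb' | hb'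
    · exact ih1 ha hab hb'
    rcases le_or_gt b a' with ha' | ha'
    · exact ih2 ha' hab hb
    · exact .trans (ih1 ha ha' le_rfl) (ih2 le_rfl hb' hb)

lemma comp_affine (h : PiecewiseArc P γ a b)
    (hP : ∀ p v (k : ℝ), 0 < k → P p v → P p (k • v)) {k m a' b' : ℝ} (hk : 0 < k)
    (ha : k * a' + m = a) (hb : k * b' + m = b) :
    PiecewiseArc P (fun t ↦ γ (k * t + m)) a' b' := by
  induction h generalizing a' b' with
  | arc h h' =>
    refine .arc ?_ (h'.comp_affine h hP hk ha hb)
    by_contra! hcon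
    nlinarith
  | @trans a b c h1 h2 ih1 ih2 =>
    have : k * ((b - m) / k) + m = b := by field_simp; ring
    exact .trans (ih1 ha this) (ih2 this hb)

lemma continuousOn (h : PiecewiseArc P γ a b) : ContinuousOn γ (Icc a b) := by
  induction h with
  | arc h h' => exact h'.1.continuousOn
  | @trans a b c h1 h2 ih1 ih2 =>
    rw [← Icc_union_Icc_eq_Icc h1.lt.le h2.lt.le]
    exact ih1.union_of_isClosed ih2 isClosed_Icc isClosed_Icc

lemma concat (h : PiecewiseArc P γ a b) (h' : PiecewiseArc P γ' b c) (hb : γ b = γ' b) :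
    PiecewiseArc P (fun t ↦ if t ≤ b then γ t else γ' t) a c := by
  refine .trans (h.congr fun t ht ↦ if_pos ht.2) (h'.congr fun t ht ↦ ?_)
  rcases ht.1.eq_or_lt with rfl | hlt
  · simp [hb]
  · simp [not_le.2 hlt]

lemma exists_partition (h : PiecewiseArc P γ a b) : ∃ (n : ℕ) (c : ℕ → ℝ), c 0 = a ∧ c n = b ∧
    ∀ i < n, c i < c (i + 1) ∧ IsArc P γ (c i) (c (i + 1)) := by
  induction h with
  | @arc a b h h' =>
    exact ⟨1, fun i ↦ if i = 0 then a else b, by simp, by simp, by simp [h, h']⟩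
  | @trans a b c h1 h2 ih1 ih2 =>
    obtain ⟨n, u, hu0, hun, hu⟩ := ih1
    obtain ⟨m, v, hv0, hvm, hv⟩ := ih2
    refine ⟨n + m, fun i ↦ if i ≤ n then u i else v (i - n), by simp [hu0], ?_, fun i hi ↦ ?_⟩
    · rcases Nat.eq_zero_or_pos m with rfl | hm
      · simp [hun, ← hvm, hv0]
      · simp [show ¬ m = 0 by omega, hvm]
    · rcases lt_trichotomy i n with h | h | h
      · simpa [h.le, Nat.succ_le_of_lt h] using hu i h
      · subst h
        have := hv 0 (by omega)
        simpa [hun, ← hv0] using this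
      · have := hv (i - n) (by omega)
        rw [show i - n + 1 = i + 1 - n by omega] at this
        simpa [show ¬ i ≤ n by omega, show ¬ i + 1 ≤ n by omega] using this

lemma of_partition {n : ℕ} {u : ℕ → ℝ} (hab : u 0 < u n)
    (h : ∀ i < n, u i < u (i + 1) ∧ IsArc P γ (u i) (u (i + 1))) :
    PiecewiseArc P γ (u 0) (u n) := by
  induction n with
  | zero => exact absurd hab (lt_irrefl _)
  | succ n ih =>
    have h1 : PiecewiseArc P γ (u n) (u (n + 1)) :=
      .arc (h n (by omega)).1 (h n (by omega)).2
    rcases Nat.eq_zero_or_pos n with rfl | hn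
    · exact h1
    · have hlt : ∀ m ≤ n, 0 < m → u 0 < u m := by
        intro m hm h0
        induction m with
        | zero => omega
        | succ m ihm =>
          rcases Nat.eq_zero_or_pos m with rfl | hm0
          · exact (h 0 (by omega)).1
          · exact (ihm (by omega) hm0).trans (h m (by omega)).1
      exact .trans (ih (hlt n le_rfl hn) fun i hi ↦ h i (by omega)) h1

lemma exists_last_arc (h : PiecewiseArc P γ a b) : ∃ t ∈ Ico a b, IsArc P γ t b := by
  induction h with
  | arc hab h => exact ⟨_, left_mem_Ico.2 hab, h⟩
  | trans h1 h2 ih1 ih2 =>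
    obtain ⟨t, ht, h⟩ := ih2
    exact ⟨t, ⟨h1.lt.le.trans ht.1, ht.2⟩, h⟩

lemma exists_first_arc (h : PiecewiseArc P γ a b) : ∃ t ∈ Ioc a b, IsArc P γ a t := by
  induction h with
  | arc hab h => exact ⟨_, right_mem_Ioc.2 hab, h⟩
  | trans h1 h2 ih1 ih2 =>
    obtain ⟨t, ht, h⟩ := ih1
    exact ⟨t, ⟨ht.1, ht.2.trans h2.lt.le⟩, h⟩

end PiecewiseArc

/-- Replaces indexed partitions by an inductive predicate, so that facts about curves follow by
induction on concatenation. -/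
lemma isPiecewiseCurve_iff {s : Set ℝ} : IsPiecewiseCurve P γ s ↔
    s.OrdConnected ∧ s.Nontrivial ∧ ∀ a ∈ s, ∀ b ∈ s, a < b → PiecewiseArc P γ a b := by
  refine and_congr Iff.rfl (and_congr Iff.rfl (forall₅_congr fun a ha b hb hab ↦ ⟨?_, ?_⟩))
  · rintro ⟨n, c, rfl, rfl, h⟩
    exact .of_partition hab h
  · exact fun h ↦ h.exists_partition

lemma PiecewiseArc.isPiecewiseCurve (h : PiecewiseArc P γ a b) :
    IsPiecewiseCurve P γ (Icc a b) := by
  refine isPiecewiseCurve_iff.2 ⟨ordConnected_Icc, ?_, fun a' ha' b' hb' hab ↦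
    h.mono ha'.1 hab hb'.2⟩
  exact ⟨a, left_mem_Icc.2 h.lt.le, b, right_mem_Icc.2 h.lt.le, h.lt.ne⟩

lemma IsPiecewiseCurve.piecewiseArc {s : Set ℝ} (h : IsPiecewiseCurve P γ s) (ha : a ∈ s)
    (hb : b ∈ s) (hab : a < b) : PiecewiseArc P γ a b :=
  (isPiecewiseCurve_iff.1 h).2.2 a ha b hb hab

/-- A continuous function takes intermediate values along a piecewise curve. -/
lemma IsPiecewiseCurve.exists_eq {s : Set ℝ} {f : M → ℝ} {t : ℝ}
    (hγ : IsPiecewiseCurve P γ s) (hf : Continuous f) {a b : ℝ} (ha : a ∈ s) (hb : b ∈ s)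
    (hab : a ≤ b) (h1 : f (γ a) ≤ t) (h2 : t ≤ f (γ b)) : ∃ u ∈ Icc a b, f (γ u) = t := by
  rcases hab.eq_or_lt with rfl | hlt
  · exact ⟨a, by simp, h1.antisymm h2⟩
  · exact intermediate_value_Icc hab
      (hf.comp_continuousOn (hγ.piecewiseArc ha hb hlt).continuousOn) ⟨h1, h2⟩

end Curves

/-! ### The chronological relation -/

section Chronology

variable {d : ℕ} {M : Type*} [TopologicalSpace M]
  [ChartedSpace (EuclideanSpace ℝ (Fin d)) M] [IsManifold (𝓡 d) ∞ M]
  {γ γ' : ℝ → M} {a b c : ℝ}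

lemma FutureTimelike.smul {S : Spacetime d M} {p : M} {v : TangentSpace (𝓡 d) p} {k : ℝ}
    (hk : 0 < k) (h : S.FutureTimelike p v) : S.FutureTimelike p (k • v) := by
  obtain ⟨h1, h2⟩ := h
  constructor
  · simp only [map_smul, FunLike.coe_smul, Pi.smul_apply, smul_eq_mul]
    nlinarith [mul_pos hk hk]
  · simp only [map_smul, smul_eq_mul]
    nlinarith

lemma FutureTimelike.futureCausal {S : Spacetime d M} {p : M} {v : TangentSpace (𝓡 d) p}
    (h : S.FutureTimelike p v) : S.FutureCausal p v := by
  refine ⟨fun h0 ↦ ?_, h.1.le, h.2⟩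
  have := h.1
  rw [h0] at this
  simp at this

variable {S : Spacetime d M} {U : Set M} {x y z : M}

lemma PiecewiseArc.chronologicalIn (h : PiecewiseArc S.FutureTimelike γ a b)
    (hU : ∀ t ∈ Icc a b, γ t ∈ U) : S.ChronologicalIn U (γ a) (γ b) :=
  ⟨γ, a, b, h.lt, h.isPiecewiseCurve, rfl, rfl, hU⟩

lemma ChronologicalIn.exists_piecewiseArc (h : S.ChronologicalIn U x y) {a b : ℝ} (hab : a < b) :
    ∃ γ, PiecewiseArc S.FutureTimelike γ a b ∧ γ a = x ∧ γ b = y ∧ ∀ t ∈ Icc a b, γ t ∈ U := by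
  obtain ⟨γ, a', b', hab', hγ, rfl, rfl, hU⟩ := h
  have h1 := hγ.piecewiseArc (left_mem_Icc.2 hab'.le) (right_mem_Icc.2 hab'.le) hab'
  have hba : 0 < b - a := sub_pos.2 hab
  have hk : 0 < (b' - a') / (b - a) := div_pos (sub_pos.2 hab') hba
  have ha : (b' - a') / (b - a) * a + (a' - (b' - a') / (b - a) * a) = a' := by ring
  have hb : (b' - a') / (b - a) * b + (a' - (b' - a') / (b - a) * a) = b' := by
    field_simp; ring
  refine ⟨_, h1.comp_affine (fun _ _ _ hk h ↦ h.smul hk) hk ha hb, by rw [ha], by rw [hb],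
    fun t ht ↦ hU _ ⟨?_, ?_⟩⟩
  · nlinarith [ht.1]
  · nlinarith [ht.2]

lemma ChronologicalIn.trans (h : S.ChronologicalIn U x y) (h' : S.ChronologicalIn U y z) :
    S.ChronologicalIn U x z := by
  obtain ⟨γ, h1, rfl, hy, hU⟩ := h.exists_piecewiseArc (a := 0) (b := 1) one_pos
  obtain ⟨γ', h2, hy', rfl, hU'⟩ := h'.exists_piecewiseArc (a := 1) (b := 2) one_lt_two
  have := (h1.concat h2 (hy.trans hy'.symm)).chronologicalIn (U := U) ?_
  · simpa [show ¬ (2 : ℝ) ≤ 1 by norm_num] using this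
  · intro t ht
    split_ifs with h
    · exact hU t ⟨ht.1, h⟩
    · exact hU' t ⟨(not_le.1 h).le, ht.2⟩

lemma ChronologicalIn.strictlyCausal (h : S.ChronologicalIn U x y) : S.StrictlyCausal x y := by
  obtain ⟨γ, h1, hx, hy, -⟩ := h.exists_piecewiseArc (a := 0) (b := 1) one_pos
  exact ⟨γ, 0, 1, one_pos, (h1.imp fun _ _ h ↦ h.futureCausal).isPiecewiseCurve, hx, hy⟩

end Chronology

/-! ### Curves in a chart -/

section CoordinateCurves

variable {d : ℕ} {M : Type*} [TopologicalSpace M]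
  [ChartedSpace (EuclideanSpace ℝ (Fin d)) M] [IsManifold (𝓡 d) ∞ M]
  {P Q : ∀ p : M, TangentSpace (𝓡 d) p → Prop} {γ : ℝ → M} {a b : ℝ}
  {e : OpenPartialHomeomorph M (EuclideanSpace ℝ (Fin d))}

/-- The chain rule for the inverse chart reduces velocity conditions on the manifold to ordinary
derivatives of Euclidean curves. -/
lemma isArc_symm_comp_iff (he : e ∈ atlas (EuclideanSpace ℝ (Fin d)) M) (hab : a < b)
    {c : ℝ → EuclideanSpace ℝ (Fin d)} (hc : ContDiffOn ℝ 1 c (Icc a b))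
    (hmaps : MapsTo c (Icc a b) e.target) :
    IsArc P (fun t ↦ e.symm (c t)) a b ↔
      ∀ t ∈ Icc a b, P (e.symm (c t)) (coordFrame e (c t) (derivWithin c (Icc a b) t)) := by
  have hs : ContMDiffOn (𝓡 d) (𝓡 d) 1 e.symm e.target :=
    (contMDiffOn_symm_of_mem_maximalAtlas (I := 𝓡 d) (n := ∞)
      (IsManifold.subset_maximalAtlas he)).of_le (by simp)
  have h1 : ContMDiffOn 𝓘(ℝ, ℝ) (𝓡 d) 1 (fun t ↦ e.symm (c t)) (Icc a b) :=
    hs.comp (contMDiffOn_iff_contDiffOn.2 hc) hmaps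
  have h2 : ∀ t ∈ Icc a b, mfderivWithin 𝓘(ℝ, ℝ) (𝓡 d) (fun t ↦ e.symm (c t)) (Icc a b) t (1 : ℝ)
      = coordFrame e (c t) (derivWithin c (Icc a b) t) := by
    intro t ht
    have hu : UniqueMDiffWithinAt 𝓘(ℝ, ℝ) (Icc a b) t :=
      (uniqueDiffOn_Icc hab t ht).uniqueMDiffWithinAt
    have h3 := mfderiv_comp_mfderivWithin (I := 𝓘(ℝ, ℝ)) (I' := 𝓡 d) (I'' := 𝓡 d) t
      (f := c) (g := e.symm) (mdiff_symm he (hmaps ht))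
      ((contMDiffOn_iff_contDiffOn.2 hc).mdifferentiableOn (by simp) t ht) hu
    rw [mfderivWithin_eq_fderivWithin] at h3
    have h4 : mfderivWithin 𝓘(ℝ, ℝ) (𝓡 d) (fun t ↦ e.symm (c t)) (Icc a b) t (1 : ℝ)
      = coordFrame e (c t) (fderivWithin ℝ c (Icc a b) t 1) :=
      congrArg (fun L : ℝ →L[ℝ] EuclideanSpace ℝ (Fin d) ↦ L (1 : ℝ)) h3
    rw [h4, fderivWithin_derivWithin]
  refine ⟨fun h t ht ↦ ?_, fun h ↦ ⟨h1, fun t ht ↦ ?_⟩⟩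
  · exact (h2 t ht) ▸ h.2 t ht
  · rw [h2 t ht]
    exact h t ht

lemma IsArc.coord (he : e ∈ atlas (EuclideanSpace ℝ (Fin d)) M) (hab : a < b)
    (h : IsArc P γ a b) (hmaps : ∀ t ∈ Icc a b, γ t ∈ e.source) :
    ContDiffOn ℝ 1 (fun t ↦ e (γ t)) (Icc a b) ∧ ∀ t ∈ Icc a b, P (e.symm (e (γ t)))
      (coordFrame e (e (γ t)) (derivWithin (fun t ↦ e (γ t)) (Icc a b) t)) := by
  have hs : ContMDiffOn (𝓡 d) (𝓡 d) 1 e e.source :=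
    (contMDiffOn_of_mem_maximalAtlas (I := 𝓡 d) (n := ∞)
      (IsManifold.subset_maximalAtlas he)).of_le (by simp)
  have h1 : ContDiffOn ℝ 1 (fun t ↦ e (γ t)) (Icc a b) :=
    contMDiffOn_iff_contDiffOn.1 (hs.comp h.1 hmaps)
  refine ⟨h1, (isArc_symm_comp_iff he hab h1 fun t ht ↦ e.map_source (hmaps t ht)).1 ?_⟩
  exact h.congr fun t ht ↦ e.left_inv (hmaps t ht)

/-- A map of the coordinate space that sends `P`-vectors to `Q`-vectors maps `P`-curves to
`Q`-curves. -/
lemma PiecewiseArc.map_coord (he : e ∈ atlas (EuclideanSpace ℝ (Fin d)) M)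
    {Φ : EuclideanSpace ℝ (Fin d) → EuclideanSpace ℝ (Fin d)} (hΦ : ContDiff ℝ 1 Φ)
    {K : Set (EuclideanSpace ℝ (Fin d))}
    (hK : ∀ x ∈ K, Φ x ∈ e.target ∧ ∀ v, P (e.symm x) (coordFrame e x v) →
      Q (e.symm (Φ x)) (coordFrame e (Φ x) (fderiv ℝ Φ x v)))
    (h : PiecewiseArc P γ a b) (hγ : ∀ t ∈ Icc a b, γ t ∈ e.source ∧ e (γ t) ∈ K) :
    PiecewiseArc Q (fun t ↦ e.symm (Φ (e (γ t)))) a b := by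
  induction h with
  | @arc a b hab h =>
    obtain ⟨h1, h2⟩ := h.coord he hab fun t ht ↦ (hγ t ht).1
    refine .arc hab ((isArc_symm_comp_iff he hab (hΦ.comp_contDiffOn h1)
      fun t ht ↦ (hK _ (hγ t ht).2).1).2 fun t ht ↦ ?_)
    have h3 : derivWithin (fun t ↦ Φ (e (γ t))) (Icc a b) t =
        fderiv ℝ Φ (e (γ t)) (derivWithin (fun t ↦ e (γ t)) (Icc a b) t) :=
      ((hΦ.differentiable (by simp)).differentiableAt.hasFDerivAt.comp_hasDerivWithinAt t
        (h1.differentiableOn (by simp) t ht).hasDerivWithinAt).derivWithin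
        (uniqueDiffOn_Icc hab t ht)
    have h4 := (hK _ (hγ t ht).2).2 _ (h2 t ht)
    rw [← h3] at h4
    exact h4
  | @trans a b c h1 h2 ih1 ih2 =>
    exact .trans (ih1 fun t ht ↦ hγ t ⟨ht.1, ht.2.trans h2.lt.le⟩)
      (ih2 fun t ht ↦ hγ t ⟨h1.lt.le.trans ht.1, ht.2⟩)

lemma chronologicalIn_of_segment (S : Spacetime d M)
    (he : e ∈ atlas (EuclideanSpace ℝ (Fin d)) M) {x x' : EuclideanSpace ℝ (Fin d)}
    (h : ∀ y ∈ segment ℝ x x', y ∈ e.target ∧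
      S.coordMetric e y (x' - x) (x' - x) < 0 ∧ S.coordTime e y (x' - x) < 0) :
    S.ChronologicalIn univ (e.symm x) (e.symm x') := by
  have hc : ContDiff ℝ 1 (fun t : ℝ ↦ x + t • (x' - x)) := by fun_prop
  have hseg : ∀ t ∈ Icc (0 : ℝ) 1, x + t • (x' - x) ∈ segment ℝ x x' := by
    intro t ht
    rw [segment_eq_image']
    exact ⟨t, ht, rfl⟩
  have h1 := (isArc_symm_comp_iff (P := S.FutureTimelike) he zero_lt_one hc.contDiffOn
    fun t ht ↦ (h _ (hseg t ht)).1).2 fun t ht ↦ by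
      have hd : HasDerivAt (fun t : ℝ ↦ x + t • (x' - x)) (x' - x) t := by
        simpa using ((hasDerivAt_id t).smul_const (x' - x)).const_add x
      rw [hd.hasDerivWithinAt.derivWithin (uniqueDiffOn_Icc zero_lt_one t ht)]
      exact (h _ (hseg t ht)).2
  have h2 := (PiecewiseArc.arc zero_lt_one h1).chronologicalIn (U := univ) (by simp)
  simpa using h2

end CoordinateCurves

/-! ### Linear algebra and stability of causal cones -/

section Cones

variable {E : Type*} [NormedAddCommGroup E] [NormedSpace ℝ E]

/-- A nonzero causal vector is not orthogonal to any timelike vector. -/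
lemma apply_ne_zero_of_causal {G : E →L[ℝ] E →L[ℝ] ℝ} (hsymm : ∀ v w, G v w = G w v)
    {u : E} (hpos : ∀ w, G u w = 0 → w ≠ 0 → 0 < G w w)
    {e v : E} (he : G e e < 0) (hv : v ≠ 0) (hvv : G v v ≤ 0) : G e v ≠ 0 := by
  intro hev
  have hue : G u e ≠ 0 := fun h ↦ by
    rcases eq_or_ne e 0 with rfl | h0
    · simp at he
    · exact (hpos e h h0).not_gt he
  -- This combination is orthogonal to `u`. If `e` and `v` were orthogonal, its square would be a
  -- sum of two nonpositive terms, so the signature forces it to vanish.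
  set w : E := (G u v) • e - (G u e) • v with hw
  have h1 : G u w = 0 := by simp [hw]; ring
  have h2 : G w w ≤ 0 := by
    have : G w w = (G u v) ^ 2 * G e e + (G u e) ^ 2 * G v v := by
      simp [hw, hev, hsymm v e]; ring
    rw [this]
    nlinarith [sq_nonneg (G u v), sq_nonneg (G u e)]
  have h3 : w = 0 := by
    by_contra h0
    exact (hpos w h1 h0).not_ge h2
  have h4 : G u v * G e e = 0 := by
    have : G e w = 0 := by rw [h3]; simp
    simpa [hw, hev] using this
  have h5 : G u v = 0 := (mul_eq_zero.1 h4).resolve_right he.ne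
  rw [h3, h5, zero_smul, zero_sub, eq_comm, neg_eq_zero] at hw
  exact (smul_ne_zero hue hv) hw

variable [FiniteDimensional ℝ E]

/-- By compactness, the maximum of `G v v` and `|G e v|` has a positive minimum on the unit sphere;
homogeneity does the rest. The estimate covers a cone slightly wider than the causal one, which
makes it stable under perturbation of the metric. -/
lemma exists_cone_bound {G : E →L[ℝ] E →L[ℝ] ℝ} {e : E}
    (h : ∀ v, v ≠ 0 → G v v ≤ 0 → G e v ≠ 0) :
    ∃ m > 0, ∀ v, G v v < m * ‖v‖ ^ 2 → m * ‖v‖ ≤ |G e v| := by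
  have : ProperSpace E := FiniteDimensional.proper ℝ E
  obtain ⟨m, hm, hmin⟩ := (isCompact_sphere (0 : E) 1).exists_forall_le'
    (f := fun v ↦ max (G v v) |G e v|) (a := 0) (by fun_prop) (fun v hv ↦ by
      have hv0 : v ≠ 0 := by
        rintro rfl
        simp at hv
      rcases lt_or_ge 0 (G v v) with h1 | h1
      · exact lt_max_of_lt_left h1
      · exact lt_max_of_lt_right (abs_pos.2 (h v hv0 h1)))
  refine ⟨m, hm, fun v hv ↦ ?_⟩
  rcases eq_or_ne v 0 with rfl | hv0
  · simp
  have hn : 0 < ‖v‖ := norm_pos_iff.2 hv0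
  have h1 := hmin (‖v‖⁻¹ • v) (by simp [norm_smul, hn.ne'])
  simp only [map_smul, FunLike.coe_smul, Pi.smul_apply, smul_eq_mul, abs_mul, abs_inv,
    abs_norm] at h1
  rcases le_max_iff.1 h1 with h2 | h2
  · have : m * ‖v‖ ^ 2 ≤ G v v := by
      have : ‖v‖⁻¹ * (‖v‖⁻¹ * G v v) = G v v / ‖v‖ ^ 2 := by field_simp
      rw [this, le_div_iff₀ (by positivity)] at h2
      exact h2
    linarith
  · have : ‖v‖⁻¹ * |G e v| = |G e v| / ‖v‖ := by field_simp
    rwa [this, le_div_iff₀ hn] at h2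

/-- In a neighbourhood of a point, the causal cones satisfy uniform estimates. -/
lemma exists_uniform_cone_estimate {G : E → E →L[ℝ] E →L[ℝ] ℝ} {T : E → E →L[ℝ] ℝ} {x₀ e : E}
    (hG : ∀ δ > 0, ∀ᶠ x in 𝓝 x₀, ‖G x - G x₀‖ < δ) (hT : ContinuousAt T x₀) (hTe : T x₀ = G x₀ e)
    (h : ∀ v, v ≠ 0 → G x₀ v v ≤ 0 → G x₀ e v ≠ 0) :
    ∃ c > 0, ∃ s ∈ 𝓝 x₀, ∀ x ∈ s, ∀ y ∈ s, ∀ v, v ≠ 0 → G x v v ≤ 0 → T x v < 0 →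
      G y e v ≤ -c * ‖v‖ ∧ T y v ≤ -c * ‖v‖ := by
  obtain ⟨m, hm, hb⟩ := exists_cone_bound h
  have hG1 : ∀ᶠ x in 𝓝 x₀, ‖G x - G x₀‖ < m / 2 := hG _ (half_pos hm)
  have hG2 : ∀ᶠ x in 𝓝 x₀, ‖G x e - G x₀ e‖ < m / 2 := by
    filter_upwards [hG (m / 2 / (‖e‖ + 1)) (by positivity)] with x hx
    have h1 : ‖G x e - G x₀ e‖ ≤ ‖G x - G x₀‖ * ‖e‖ := (G x - G x₀).le_opNorm e
    rw [lt_div_iff₀ (by positivity)] at hx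
    nlinarith [norm_nonneg (G x - G x₀)]
  have hT1 : ∀ᶠ x in 𝓝 x₀, ‖T x - G x₀ e‖ < m / 2 := by
    have := hT.eventually_mem (Metric.ball_mem_nhds _ (half_pos hm))
    simpa [dist_eq_norm, hTe] using this
  have key : ∀ (A B : E →L[ℝ] ℝ) v, ‖A - B‖ < m / 2 → A v - B v ≤ m / 2 * ‖v‖ ∧
      B v - A v ≤ m / 2 * ‖v‖ := by
    intro A B v hAB
    have h1 : ‖A v - B v‖ ≤ ‖A - B‖ * ‖v‖ := (A - B).le_opNorm v
    have h2 : ‖A - B‖ * ‖v‖ ≤ m / 2 * ‖v‖ := by gcongr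
    have h3 := abs_le.1 ((Real.norm_eq_abs _) ▸ h1.trans h2)
    constructor <;> linarith [h3.1, h3.2]
  refine ⟨m / 2, half_pos hm, _, hG1.and (hG2.and hT1), ?_⟩
  rintro x ⟨hx1, -, hx2⟩ y ⟨-, hy1, hy2⟩ v hv0 hv1 hv2
  have hn : 0 < ‖v‖ := norm_pos_iff.2 hv0
  have h1 : G x₀ v v < m * ‖v‖ ^ 2 := by
    have h2 : ‖(G x - G x₀) v v‖ ≤ ‖G x - G x₀‖ * ‖v‖ * ‖v‖ := (G x - G x₀).le_opNorm₂ v v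
    have h3 : ‖G x - G x₀‖ * ‖v‖ * ‖v‖ ≤ m / 2 * ‖v‖ * ‖v‖ := by gcongr
    have h4 := (abs_le.1 ((Real.norm_eq_abs _) ▸ h2.trans h3)).1
    simp only [FunLike.coe_sub, Pi.sub_apply] at h4
    nlinarith [mul_pos hn hn]
  have h2 := hb v h1
  have h3 := (key _ _ v hx2).2
  -- The time orientation at `x` selects the negative branch of the absolute value.
  have h4 : G x₀ e v ≤ -(m * ‖v‖) := by
    rcases le_abs'.1 h2 with h | h
    · exact h
    · nlinarith
  constructor
  · linarith [(key _ _ v hy1).1]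
  · linarith [(key _ _ v hy2).1]

/-- Causal vectors become timelike at nearby points when pushed in a timelike direction. -/
lemma exists_push {G : E → E →L[ℝ] E →L[ℝ] ℝ} {T : E → E →L[ℝ] ℝ} {x₀ e : E}
    (hsymm : ∀ x v w, G x v w = G x w v)
    (hG : ContDiffAt ℝ 1 G x₀) (hT : ContinuousAt T x₀) (hTe : T x₀ = G x₀ e)
    (hee : G x₀ e e < 0) (h : ∀ v, v ≠ 0 → G x₀ v v ≤ 0 → G x₀ e v ≠ 0) :
    ∃ κ > 0, ∃ R > 0, ∀ x ∈ Metric.ball x₀ R, ∀ y ∈ Metric.ball x₀ R, ∀ (η : ℝ) (v : E), 0 < η →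
      ‖y - x‖ ≤ κ * η → v ≠ 0 → G x v v ≤ 0 → T x v < 0 →
      G y (v + (η * (-G x₀ e v)) • e) (v + (η * (-G x₀ e v)) • e) < 0 ∧
        T y (v + (η * (-G x₀ e v)) • e) < 0 := by
  have hG0 : ∀ δ > 0, ∀ᶠ x in 𝓝 x₀, ‖G x - G x₀‖ < δ := fun δ hδ ↦ by
    simpa [dist_eq_norm] using Metric.tendsto_nhds.1 hG.continuousAt δ hδ
  obtain ⟨c, hc, s, hs, hcone⟩ := exists_uniform_cone_estimate hG0 hT hTe h
  obtain ⟨L, t, ht, hL⟩ := hG.exists_lipschitzOnWith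
  have hee' : ∀ᶠ y in 𝓝 x₀, G y e e < 0 := by
    have h1 : ContinuousAt (fun y ↦ G y e e) x₀ :=
      (hG.continuousAt.clm_apply continuousAt_const).clm_apply continuousAt_const
    exact h1.eventually_lt continuousAt_const hee
  have hTe' : ∀ᶠ y in 𝓝 x₀, T y e < 0 := by
    have h1 : ContinuousAt (fun y ↦ T y e) x₀ := hT.clm_apply continuousAt_const
    exact h1.eventually_lt continuousAt_const (by rw [hTe]; exact hee)
  obtain ⟨R, hR, hball⟩ := Metric.mem_nhds_iff.1
    (inter_mem hs (inter_mem ht (hee'.and hTe')))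
  have hκ : L * (c ^ 2 / (L + 1)) ≤ c ^ 2 := by
    rw [mul_div_assoc', div_le_iff₀ (by positivity)]
    nlinarith [sq_nonneg c]
  -- Moving from `x` to `y` changes `G v v` by at most `c² η ‖v‖²`, half of what the cross term `2 η
  -- k G(e, v)` gains. The `+ 1` avoids division by zero when `L = 0`.
  refine ⟨c ^ 2 / (L + 1), by positivity, R, hR, fun x hx y hy η v hη hxy hv0 hv1 hv2 ↦ ?_⟩
  obtain ⟨hx1, hx2, -⟩ := hball hx
  obtain ⟨hy1, hy2, hy3, hy4⟩ := hball hy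
  obtain ⟨h1, h2⟩ := hcone x hx1 y hy1 v hv0 hv1 hv2
  have h3 := (hcone x hx1 x₀ (mem_of_mem_nhds hs) v hv0 hv1 hv2).1
  have hn : 0 < ‖v‖ := norm_pos_iff.2 hv0
  set k := -G x₀ e v with hk
  have hkc : c * ‖v‖ ≤ k := by rw [hk]; linarith
  have hk0 : 0 < k := (mul_pos hc hn).trans_le hkc
  have h4 : G y v v ≤ c ^ 2 * η * ‖v‖ ^ 2 := by
    have h5 : ‖(G y - G x) v v‖ ≤ ‖G y - G x‖ * ‖v‖ * ‖v‖ := (G y - G x).le_opNorm₂ v v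
    have h6 : ‖G y - G x‖ ≤ L * (c ^ 2 / (L + 1) * η) := by
      refine (hL.norm_sub_le hy2 hx2).trans ?_
      gcongr
    have h7 : ‖G y - G x‖ * ‖v‖ * ‖v‖ ≤ c ^ 2 * η * ‖v‖ * ‖v‖ := by
      gcongr
      refine h6.trans ?_
      rw [← mul_assoc]
      gcongr
    have h8 := (abs_le.1 ((Real.norm_eq_abs _) ▸ h5.trans h7)).2
    simp only [FunLike.coe_sub, Pi.sub_apply] at h8
    nlinarith
  constructor
  · have h9 : G y (v + (η * k) • e) (v + (η * k) • e) =
        G y v v + 2 * (η * k) * G y e v + (η * k) ^ 2 * G y e e := by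
      simp [hsymm y v e]; ring
    have h10 : 2 * (η * k) * G y e v ≤ 2 * (η * (c * ‖v‖)) * (-c * ‖v‖) := by
      have : (η * k) * (c * ‖v‖) ≥ (η * (c * ‖v‖)) * (c * ‖v‖) := by gcongr
      nlinarith [mul_pos hη hk0]
    have h11 : (η * k) ^ 2 * G y e e < 0 := mul_neg_of_pos_of_neg (by positivity) hy3
    have h12 : 0 < c ^ 2 * η * ‖v‖ ^ 2 := by positivity
    rw [h9]
    nlinarith
  · have h9 : T y (v + (η * k) • e) = T y v + η * k * T y e := by simp
    rw [h9]
    nlinarith [mul_pos hη hk0, mul_pos hc hn]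

end Cones

/-! ### Shears and short timelike segments -/

section LocalCausality

variable {d : ℕ} {M : Type*} [TopologicalSpace M]
  [ChartedSpace (EuclideanSpace ℝ (Fin d)) M] [IsManifold (𝓡 d) ∞ M]
  {e : OpenPartialHomeomorph M (EuclideanSpace ℝ (Fin d))} {y : EuclideanSpace ℝ (Fin d)}
  {S : Spacetime d M} {p q r x z : M}

lemma coordMetric_symm (S : Spacetime d M)
    (e : OpenPartialHomeomorph M (EuclideanSpace ℝ (Fin d)))
    (y v w : EuclideanSpace ℝ (Fin d)) : S.coordMetric e y v w = S.coordMetric e y w v :=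
  S.metric_symm _ _ _

/-- The time direction in the coordinates of the chart `e`. -/
def coordTimeDir (S : Spacetime d M) (e : OpenPartialHomeomorph M (EuclideanSpace ℝ (Fin d)))
    (y : EuclideanSpace ℝ (Fin d)) : EuclideanSpace ℝ (Fin d) :=
  coordVec e y (S.timeVec (e.symm y))

lemma coordFrame_coordTimeDir (S : Spacetime d M)
    (he : e ∈ atlas (EuclideanSpace ℝ (Fin d)) M) (hy : y ∈ e.target) :
    coordFrame e y (S.coordTimeDir e y) = S.timeVec (e.symm y) :=
  coordFrame_coordVec he hy _

lemma coordTime_eq (S : Spacetime d M)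
    (he : e ∈ atlas (EuclideanSpace ℝ (Fin d)) M) (hy : y ∈ e.target) :
    S.coordTime e y = S.coordMetric e y (S.coordTimeDir e y) := by
  ext v
  rw [coordTime_apply, coordMetric_apply, coordFrame_coordTimeDir S he hy]

lemma coordMetric_coordTimeDir (S : Spacetime d M)
    (he : e ∈ atlas (EuclideanSpace ℝ (Fin d)) M) (hy : y ∈ e.target) :
    S.coordMetric e y (S.coordTimeDir e y) (S.coordTimeDir e y) < 0 := by
  rw [coordMetric_apply, coordFrame_coordTimeDir S he hy]
  exact S.timeDir_timelike _

lemma coordMetric_signature (S : Spacetime d M)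
    (he : e ∈ atlas (EuclideanSpace ℝ (Fin d)) M) (hy : y ∈ e.target) :
    ∃ u, S.coordMetric e y u u < 0 ∧
      ∀ w, S.coordMetric e y u w = 0 → w ≠ 0 → 0 < S.coordMetric e y w w := by
  obtain ⟨v, hv, hpos⟩ := S.metric_signature (e.symm y)
  have h1 : coordFrame e y (coordVec e y v) = v := coordFrame_coordVec he hy v
  refine ⟨coordVec e y v, ?_, fun w hw hw0 ↦ ?_⟩
  · rw [coordMetric_apply, h1]
    exact hv
  · rw [coordMetric_apply, h1] at hw
    refine hpos _ hw fun h0 ↦ hw0 ?_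
    rw [← coordVec_coordFrame he hy w]
    exact (congrArg (coordVec e y) h0).trans (map_zero (coordVec e y))

lemma coordMetric_apply_ne_zero (S : Spacetime d M)
    (he : e ∈ atlas (EuclideanSpace ℝ (Fin d)) M) (hy : y ∈ e.target)
    {v : EuclideanSpace ℝ (Fin d)} (hv : v ≠ 0) (hvv : S.coordMetric e y v v ≤ 0) :
    S.coordMetric e y (S.coordTimeDir e y) v ≠ 0 := by
  obtain ⟨u, -, hu⟩ := S.coordMetric_signature he hy
  exact apply_ne_zero_of_causal (S.coordMetric_symm e y) hu (S.coordMetric_coordTimeDir he hy)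
    hv hvv

/-- Around each point there are coordinate balls in which every causal curve becomes timelike when
it is sheared in the time direction, even when it is also translated by a small vector. -/
lemma exists_shear (S : Spacetime d M) (p : M) :
    ∃ (w : EuclideanSpace ℝ (Fin d)) (h : EuclideanSpace ℝ (Fin d) →L[ℝ] ℝ), ∃ r > 0, ∃ κ > 0,
      ∃ η₀ > 0, Metric.closedBall (chartAt (EuclideanSpace ℝ (Fin d)) p p) r ⊆
        (chartAt (EuclideanSpace ℝ (Fin d)) p).target ∧
      ∀ x ∈ Metric.closedBall (chartAt (EuclideanSpace ℝ (Fin d)) p p) r,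
      ∀ s ∈ Metric.closedBall (chartAt (EuclideanSpace ℝ (Fin d)) p p) r,
      ∀ (u : EuclideanSpace ℝ (Fin d)) (η : ℝ), 0 < η → η ≤ η₀ → ‖u‖ ≤ κ * η →
        (x + u + (η * (h x - h s)) • w) ∈ (chartAt (EuclideanSpace ℝ (Fin d)) p).target ∧
        ∀ v, S.FutureCausal ((chartAt (EuclideanSpace ℝ (Fin d)) p).symm x)
            (coordFrame (chartAt (EuclideanSpace ℝ (Fin d)) p) x v) →
          S.FutureTimelike ((chartAt (EuclideanSpace ℝ (Fin d)) p).symm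
            (x + u + (η * (h x - h s)) • w))
            (coordFrame (chartAt (EuclideanSpace ℝ (Fin d)) p)
              (x + u + (η * (h x - h s)) • w) (v + (η * h v) • w)) := by
  set e := chartAt (EuclideanSpace ℝ (Fin d)) p with he_def
  have he : e ∈ atlas (EuclideanSpace ℝ (Fin d)) M := chart_mem_atlas _ p
  set x₀ := e p with hx₀
  have hx₀t : x₀ ∈ e.target := e.map_source (mem_chart_source _ p)
  obtain ⟨κ, hκ, R, hR, hpush⟩ := exists_push (x₀ := x₀) (e := S.coordTimeDir e x₀)
    (S.coordMetric_symm e) ((S.contDiffAt_coordMetric he hx₀t).of_le (by simp))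
    (S.continuousAt_coordTime he hx₀t) (S.coordTime_eq he hx₀t)
    (S.coordMetric_coordTimeDir he hx₀t) fun v ↦ S.coordMetric_apply_ne_zero he hx₀t
  obtain ⟨R', hR', hball⟩ := Metric.isOpen_iff.1 e.open_target x₀ hx₀t
  set w := S.coordTimeDir e x₀
  -- With this `h`, the map `x ↦ x + u + (η * (h x - h s)) • w` has differential `v ↦ v + (η * h v)
  -- • w`, exactly the push of `exists_push`.
  set h : EuclideanSpace ℝ (Fin d) →L[ℝ] ℝ := -S.coordMetric e x₀ w with hh
  set ρ := min R R' with hρ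
  have hρ0 : 0 < ρ := lt_min hR hR'
  set C := ‖h‖ * ‖w‖ with hC
  have hC0 : 0 ≤ C := by positivity
  set r := min (ρ / 2) (κ / (4 * (C + 1))) with hr
  have hr0 : 0 < r := lt_min (by positivity) (by positivity)
  have hrC : r * (4 * (C + 1)) ≤ κ := by
    rw [← le_div_iff₀ (by positivity)]
    exact min_le_right _ _
  have hrρ : r ≤ ρ / 2 := min_le_left _ _
  -- The displacement `κ * η` is shared equally: `κ / 2` bounds the translation, and the size of `r`
  -- bounds the shear. The bound on `η` keeps the displaced point in the ball of radius `ρ`.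
  refine ⟨w, h, r, hr0, κ / 2, by positivity, ρ / (4 * κ), by positivity, ?_, ?_⟩
  · refine (Metric.closedBall_subset_ball ?_).trans hball
    linarith [min_le_right R R']
  intro x hx s hs u η hη hη₀ hu
  set y := x + u + (η * (h x - h s)) • w with hy
  have h1 : ‖y - x‖ ≤ κ * η := by
    have h2 : |h x - h s| ≤ ‖h‖ * (2 * r) := by
      rw [← map_sub, ← Real.norm_eq_abs]
      refine (h.le_opNorm _).trans ?_
      gcongr
      rw [← dist_eq_norm]
      linarith [dist_triangle_right x s x₀, Metric.mem_closedBall.1 hx, Metric.mem_closedBall.1 hs]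
    have h3 : y - x = u + (η * (h x - h s)) • w := by rw [hy]; abel
    rw [h3]
    refine (norm_add_le _ _).trans ?_
    rw [norm_smul, Real.norm_eq_abs, abs_mul, abs_of_pos hη]
    have h4 : η * |h x - h s| * ‖w‖ ≤ η * (‖h‖ * (2 * r)) * ‖w‖ := by gcongr
    have h5 : η * (‖h‖ * (2 * r)) * ‖w‖ = η * (2 * r * C) := by rw [hC]; ring
    nlinarith
  have hxρ : x ∈ Metric.ball x₀ ρ :=
    Metric.closedBall_subset_ball (by linarith) hx
  have hyρ : y ∈ Metric.ball x₀ ρ := by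
    rw [Metric.mem_ball]
    have h2 : dist y x ≤ ρ / 4 := by
      rw [dist_eq_norm]
      refine h1.trans ?_
      rw [le_div_iff₀ (by positivity)] at hη₀
      linarith
    linarith [dist_triangle y x x₀, Metric.mem_closedBall.1 hx]
  have hxt : x ∈ e.target := hball (Metric.ball_subset_ball (min_le_right _ _) hxρ)
  refine ⟨hball (Metric.ball_subset_ball (min_le_right _ _) hyρ), fun v hv ↦ ?_⟩
  obtain ⟨hv0, hv1, hv2⟩ := (S.futureCausal_coordFrame he hxt v).1 hv
  exact hpush x (Metric.ball_subset_ball (min_le_left _ _) hxρ) y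
    (Metric.ball_subset_ball (min_le_left _ _) hyρ) η v hη h1 hv0 hv1 hv2

/-- A short segment whose direction is close to a timelike vector is a timelike curve. -/
lemma exists_segment (S : Spacetime d M) (he : e ∈ atlas (EuclideanSpace ℝ (Fin d)) M)
    (hy : y ∈ e.target) {v : EuclideanSpace ℝ (Fin d)}
    (hv : S.FutureTimelike (e.symm y) (coordFrame e y v)) :
    ∃ ρ > 0, Metric.ball y ρ ⊆ e.target ∧ ∀ x ∈ Metric.ball y ρ, ∀ x' ∈ Metric.ball y ρ, ∀ ε > 0,
      ‖x' - x - ε • v‖ < ρ * ε → S.ChronologicalIn univ (e.symm x) (e.symm x') := by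
  have hG : ContinuousAt (fun a : EuclideanSpace ℝ (Fin d) × EuclideanSpace ℝ (Fin d) ↦
      S.coordMetric e a.1 a.2 a.2) (y, v) := by
    have h1 : ContinuousAt (fun a : EuclideanSpace ℝ (Fin d) × EuclideanSpace ℝ (Fin d) ↦
      S.coordMetric e a.1) (y, v) :=
      ContinuousAt.comp (g := S.coordMetric e) (x := (y, v)) (S.contDiffAt_coordMetric he hy).continuousAt
        continuousAt_fst
    exact (h1.clm_apply continuousAt_snd).clm_apply continuousAt_snd
  have hT : ContinuousAt (fun a : EuclideanSpace ℝ (Fin d) × EuclideanSpace ℝ (Fin d) ↦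
      S.coordTime e a.1 a.2) (y, v) := by
    have h1 : ContinuousAt (fun a : EuclideanSpace ℝ (Fin d) × EuclideanSpace ℝ (Fin d) ↦
      S.coordTime e a.1) (y, v) :=
      ContinuousAt.comp (g := S.coordTime e) (x := (y, v)) (S.continuousAt_coordTime he hy) continuousAt_fst
    exact h1.clm_apply continuousAt_snd
  have h1 := hG.eventually_lt continuousAt_const hv.1
  have h2 := hT.eventually_lt continuousAt_const hv.2
  have h3 : ∀ᶠ a : EuclideanSpace ℝ (Fin d) × EuclideanSpace ℝ (Fin d) in 𝓝 (y, v),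
      a.1 ∈ e.target := continuousAt_fst.eventually_mem (e.open_target.mem_nhds hy)
  obtain ⟨ρ, hρ, hball⟩ := Metric.eventually_nhds_iff_ball.1 (h1.and (h2.and h3))
  refine ⟨ρ, hρ, fun x hx ↦ (hball (x, v) ?_).2.2, fun x hx x' hx' ε hε hxx ↦ ?_⟩
  · rw [← ball_prod_same]
    exact ⟨hx, Metric.mem_ball_self hρ⟩
  refine chronologicalIn_of_segment S he fun z hz ↦ ?_
  have hz' : z ∈ Metric.ball y ρ := (convex_ball y ρ).segment_subset hx hx' hz
  have h4 : ε⁻¹ • (x' - x) ∈ Metric.ball v ρ := by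
    rw [Metric.mem_ball, dist_eq_norm]
    have : ε⁻¹ • (x' - x) - v = ε⁻¹ • (x' - x - ε • v) := by
      rw [smul_sub ε⁻¹ (x' - x), inv_smul_smul₀ hε.ne']
    rw [this, norm_smul, norm_inv, Real.norm_eq_abs, abs_of_pos hε, inv_mul_lt_iff₀ hε]
    linarith
  obtain ⟨h5, h6, h7⟩ := hball (z, ε⁻¹ • (x' - x)) (by rw [← ball_prod_same]; exact ⟨hz', h4⟩)
  have hi : 0 < ε⁻¹ := inv_pos.2 hε
  simp only [map_smul, FunLike.coe_smul, Pi.smul_apply, smul_eq_mul] at h5 h6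
  exact ⟨h7, not_le.1 fun hc ↦ h5.not_ge (mul_nonneg hi.le (mul_nonneg hi.le hc)),
    not_le.1 fun hc ↦ h6.not_ge (mul_nonneg hi.le hc)⟩

end LocalCausality

/-! ### Openness of chronological pasts and futures -/

section Openness

variable {d : ℕ} {M : Type*} [TopologicalSpace M]
  [ChartedSpace (EuclideanSpace ℝ (Fin d)) M]

lemma tendsto_displacement (p : M) (v : EuclideanSpace ℝ (Fin d)) :
    Tendsto (fun s : ℝ ↦ (chartAt (EuclideanSpace ℝ (Fin d)) p).symm
      (chartAt (EuclideanSpace ℝ (Fin d)) p p + s • v)) (𝓝 0) (𝓝 p) := by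
  set e := chartAt (EuclideanSpace ℝ (Fin d)) p
  have hp : p ∈ e.source := mem_chart_source _ p
  have h1 : Tendsto (fun s : ℝ ↦ e p + s • v) (𝓝 0) (𝓝 (e p)) := by
    have : ContinuousAt (fun s : ℝ ↦ e p + s • v) 0 := by fun_prop
    simpa [ContinuousAt] using this
  have h2 := (e.continuousAt_symm (e.map_source hp)).tendsto.comp h1
  rwa [e.left_inv hp] at h2

end Openness

section Openness

variable {d : ℕ} {M : Type*} [TopologicalSpace M]
  [ChartedSpace (EuclideanSpace ℝ (Fin d)) M] [IsManifold (𝓡 d) ∞ M]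
  {S : Spacetime d M} {p q r x y z : M} {γ : ℝ → M} {a b : ℝ}

/-- `x ≪ y`: a future-directed timelike curve leads from `x` to `y`. -/
abbrev Chron (S : Spacetime d M) (x y : M) : Prop := S.ChronologicalIn univ x y

lemma PiecewiseArc.chron (h : PiecewiseArc S.FutureTimelike γ a b) : S.Chron (γ a) (γ b) :=
  h.chronologicalIn (by simp)

/-- By differentiability, the chord from `γ t` to `γ b` is `(b - t) • v` up to `o(b - t)`. Once `t`
is close to `b`, the far end may also move by a small multiple of `b - t` without the segment
ceasing to be timelike; each error takes half of the margin `ρ`. -/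
lemma IsArc.eventually_chron_right (hab : a < b) (h : IsArc S.FutureTimelike γ a b) :
    ∃ t ∈ Ioo a b, ∀ᶠ y in 𝓝 (γ b), S.Chron (γ t) y := by
  set e := chartAt (EuclideanSpace ℝ (Fin d)) (γ b) with he_def
  have he : e ∈ atlas (EuclideanSpace ℝ (Fin d)) M := chart_mem_atlas _ _
  have hb : γ b ∈ e.source := mem_chart_source _ _
  have h1 : ∀ᶠ t in 𝓝[≤] b, γ t ∈ e.source := by
    rw [← nhdsWithin_Icc_eq_nhdsLE hab]
    exact (h.1.continuousOn b (right_mem_Icc.2 hab.le)).eventually_mem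
      (e.open_source.mem_nhds hb)
  obtain ⟨a', ha', h2⟩ := (mem_nhdsLE_iff_exists_mem_Ico_Ioc_subset hab).1 h1
  set a₁ := (a' + b) / 2
  have ha₁ : a' < a₁ := by simp only [a₁]; linarith [ha'.2]
  have hb₁ : a₁ < b := by simp only [a₁]; linarith [ha'.2]
  obtain ⟨hc, hv⟩ := (h.mono (ha'.1.trans ha₁.le) hb₁ le_rfl).coord he hb₁
    fun t ht ↦ h2 ⟨ha₁.trans_le ht.1, ht.2⟩
  set c : ℝ → EuclideanSpace ℝ (Fin d) := fun t ↦ e (γ t) with hcdef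
  obtain ⟨ρ, hρ, -, hseg⟩ := exists_segment S he (e.map_source hb)
    (hv b (right_mem_Icc.2 hb₁.le))
  set v := derivWithin c (Icc a₁ b) b
  have hd : HasDerivWithinAt c v (Icc a₁ b) b :=
    (hc.differentiableOn (by simp) b (right_mem_Icc.2 hb₁.le)).hasDerivWithinAt
  have h3 := (hasDerivWithinAt_iff_isLittleO.1 hd).def (half_pos hρ)
  have h4 : ∀ᶠ t in 𝓝[Icc a₁ b] b, c t ∈ Metric.ball (c b) ρ :=
    hd.continuousWithinAt.eventually_mem (Metric.ball_mem_nhds _ hρ)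
  have h5 := h3.and h4
  rw [nhdsWithin_Icc_eq_nhdsLE hb₁] at h5
  have h6 : ∀ᶠ t in 𝓝[<] b, t ∈ Ioo a₁ b := Ioo_mem_nhdsLT hb₁
  obtain ⟨t, ⟨h7, h8⟩, h9⟩ := ((h5.filter_mono (nhdsWithin_mono b Iio_subset_Iic_self)).and h6).exists
  have hbt : 0 < b - t := sub_pos.2 h9.2
  refine ⟨t, ⟨ha'.1.trans_lt (ha₁.trans h9.1), h9.2⟩, ?_⟩
  have h10 : ∀ᶠ y in 𝓝 (γ b), e y ∈ Metric.ball (e (γ b)) (min ρ (ρ / 2 * (b - t))) :=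
    (e.continuousAt hb).eventually_mem (Metric.ball_mem_nhds _ (lt_min hρ (by positivity)))
  filter_upwards [h10, e.open_source.mem_nhds hb] with y hy1 hy2
  have h11 := hseg (c t) h8 (e y) (Metric.ball_subset_ball (min_le_left _ _) hy1) (b - t) hbt ?_
  · rwa [e.left_inv hy2, hcdef, e.left_inv (h2 ⟨ha₁.trans h9.1, h9.2.le⟩)] at h11
  · have h12 : ‖e y - e (γ b)‖ < ρ / 2 * (b - t) := by
      rw [← dist_eq_norm]
      exact (Metric.mem_ball.1 hy1).trans_le (min_le_right _ _)
    rw [Real.norm_eq_abs, abs_sub_comm, abs_of_pos hbt] at h7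
    have h13 : e y - c t - (b - t) • v = (e y - e (γ b)) - (c t - c b - (t - b) • v) := by
      rw [hcdef]
      module
    rw [h13]
    refine (norm_sub_le _ _).trans_lt ?_
    linarith

lemma IsArc.eventually_chron_left (hab : a < b) (h : IsArc S.FutureTimelike γ a b) :
    ∃ t ∈ Ioo a b, ∀ᶠ y in 𝓝 (γ a), S.Chron y (γ t) := by
  set e := chartAt (EuclideanSpace ℝ (Fin d)) (γ a) with he_def
  have he : e ∈ atlas (EuclideanSpace ℝ (Fin d)) M := chart_mem_atlas _ _
  have ha : γ a ∈ e.source := mem_chart_source _ _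
  have h1 : ∀ᶠ t in 𝓝[≥] a, γ t ∈ e.source := by
    rw [← nhdsWithin_Icc_eq_nhdsGE hab]
    exact (h.1.continuousOn a (left_mem_Icc.2 hab.le)).eventually_mem
      (e.open_source.mem_nhds ha)
  obtain ⟨b', hb', h2⟩ := (mem_nhdsGE_iff_exists_mem_Ioc_Ico_subset hab).1 h1
  set b₁ := (a + b') / 2
  have hb₁ : b₁ < b' := by simp only [b₁]; linarith [hb'.1]
  have ha₁ : a < b₁ := by simp only [b₁]; linarith [hb'.1]
  obtain ⟨hc, hv⟩ := (h.mono le_rfl ha₁ (hb₁.le.trans hb'.2)).coord he ha₁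
    fun t ht ↦ h2 ⟨ht.1, ht.2.trans_lt hb₁⟩
  set c : ℝ → EuclideanSpace ℝ (Fin d) := fun t ↦ e (γ t) with hcdef
  obtain ⟨ρ, hρ, -, hseg⟩ := exists_segment S he (e.map_source ha)
    (hv a (left_mem_Icc.2 ha₁.le))
  set v := derivWithin c (Icc a b₁) a
  have hd : HasDerivWithinAt c v (Icc a b₁) a :=
    (hc.differentiableOn (by simp) a (left_mem_Icc.2 ha₁.le)).hasDerivWithinAt
  have h3 := (hasDerivWithinAt_iff_isLittleO.1 hd).def (half_pos hρ)
  have h4 : ∀ᶠ t in 𝓝[Icc a b₁] a, c t ∈ Metric.ball (c a) ρ :=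
    hd.continuousWithinAt.eventually_mem (Metric.ball_mem_nhds _ hρ)
  have h5 := h3.and h4
  rw [nhdsWithin_Icc_eq_nhdsGE ha₁] at h5
  have h6 : ∀ᶠ t in 𝓝[>] a, t ∈ Ioo a b₁ := Ioo_mem_nhdsGT ha₁
  obtain ⟨t, ⟨h7, h8⟩, h9⟩ := ((h5.filter_mono (nhdsWithin_mono a Ioi_subset_Ici_self)).and h6).exists
  have hat : 0 < t - a := sub_pos.2 h9.1
  refine ⟨t, ⟨h9.1, h9.2.trans (hb₁.trans_le hb'.2)⟩, ?_⟩
  have h10 : ∀ᶠ y in 𝓝 (γ a), e y ∈ Metric.ball (e (γ a)) (min ρ (ρ / 2 * (t - a))) :=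
    (e.continuousAt ha).eventually_mem (Metric.ball_mem_nhds _ (lt_min hρ (by positivity)))
  filter_upwards [h10, e.open_source.mem_nhds ha] with y hy1 hy2
  have h11 := hseg (e y) (Metric.ball_subset_ball (min_le_left _ _) hy1) (c t) h8 (t - a) hat ?_
  · rwa [e.left_inv hy2, hcdef, e.left_inv (h2 ⟨h9.1.le, h9.2.trans hb₁⟩)] at h11
  · have h12 : ‖e y - e (γ a)‖ < ρ / 2 * (t - a) := by
      rw [← dist_eq_norm]
      exact (Metric.mem_ball.1 hy1).trans_le (min_le_right _ _)
    rw [Real.norm_eq_abs, abs_of_pos hat] at h7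
    have h13 : c t - e y - (t - a) • v = (c t - c a - (t - a) • v) - (e y - e (γ a)) := by
      rw [hcdef]
      module
    rw [h13]
    refine (norm_sub_le _ _).trans_lt ?_
    linarith

lemma isOpen_chronologicalFuture (S : Spacetime d M) (x : M) : IsOpen {y | S.Chron x y} := by
  refine isOpen_iff_mem_nhds.2 fun y hy ↦ ?_
  obtain ⟨γ, h, rfl, rfl, -⟩ := hy.exists_piecewiseArc (a := 0) (b := 1) one_pos
  obtain ⟨t, ht, h1⟩ := h.exists_last_arc
  obtain ⟨u, hu, h2⟩ := h1.eventually_chron_right ht.2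
  filter_upwards [h2] with z hz
  exact ((h.mono le_rfl (ht.1.trans_lt hu.1) hu.2.le).chron).trans hz

lemma isOpen_chronologicalPast (S : Spacetime d M) (x : M) : IsOpen {y | S.Chron y x} := by
  refine isOpen_iff_mem_nhds.2 fun y hy ↦ ?_
  obtain ⟨γ, h, rfl, rfl, -⟩ := hy.exists_piecewiseArc (a := 0) (b := 1) one_pos
  obtain ⟨t, ht, h1⟩ := h.exists_first_arc
  obtain ⟨u, hu, h2⟩ := h1.eventually_chron_left ht.1
  filter_upwards [h2] with z hz
  exact hz.trans (h.mono hu.1.le (hu.2.trans_le ht.2) le_rfl).chron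

lemma Chron.eventually_right (h : S.Chron x y) : ∀ᶠ z in 𝓝 y, S.Chron x z :=
  (isOpen_chronologicalFuture S x).mem_nhds h

lemma Chron.eventually_left (h : S.Chron x y) : ∀ᶠ z in 𝓝 x, S.Chron z y :=
  (isOpen_chronologicalPast S y).mem_nhds h

/-- Near each point `p`, the points displaced in the time direction of the chart at `p`. -/
lemma exists_displacement (S : Spacetime d M) (p : M) : ∃ v : EuclideanSpace ℝ (Fin d),
    ∃ ρ > 0, Metric.ball (chartAt (EuclideanSpace ℝ (Fin d)) p p) ρ ⊆
      (chartAt (EuclideanSpace ℝ (Fin d)) p).target ∧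
    ∀ x ∈ Metric.ball (chartAt (EuclideanSpace ℝ (Fin d)) p p) ρ, ∀ s : ℝ, 0 < s →
      x + s • v ∈ Metric.ball (chartAt (EuclideanSpace ℝ (Fin d)) p p) ρ →
      S.Chron ((chartAt (EuclideanSpace ℝ (Fin d)) p).symm x)
        ((chartAt (EuclideanSpace ℝ (Fin d)) p).symm (x + s • v)) := by
  set e := chartAt (EuclideanSpace ℝ (Fin d)) p with he_def
  have he : e ∈ atlas (EuclideanSpace ℝ (Fin d)) M := chart_mem_atlas _ p
  have hp : e p ∈ e.target := e.map_source (mem_chart_source _ p)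
  have h1 := S.coordMetric_coordTimeDir he hp
  have h2 : S.FutureTimelike (e.symm (e p)) (coordFrame e (e p) (S.coordTimeDir e (e p))) :=
    ⟨h1, by
      have h3 := S.coordTime_eq he hp
      have h4 : S.coordTime e (e p) (S.coordTimeDir e (e p)) < 0 := by rw [h3]; exact h1
      exact h4⟩
  obtain ⟨ρ, hρ, hball, h⟩ := exists_segment S he hp h2
  exact ⟨S.coordTimeDir e (e p), ρ, hρ, hball, fun x hx s hs hxs ↦
    -- The displacement is an exact multiple of the timelike direction, so the error allowed by
    -- `exists_segment` is zero here.
    h x hx _ hxs s hs (by simpa using mul_pos hρ hs)⟩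

lemma exists_chron_right_mem (S : Spacetime d M) {U : Set M} (hU : U ∈ 𝓝 p) :
    ∃ q ∈ U, S.Chron p q := by
  obtain ⟨v, ρ, hρ, -, h⟩ := exists_displacement S p
  have h1 : ∀ᶠ s : ℝ in 𝓝 0, chartAt (EuclideanSpace ℝ (Fin d)) p p + s • v ∈
      Metric.ball (chartAt (EuclideanSpace ℝ (Fin d)) p p) ρ := by
    have : ContinuousAt (fun s : ℝ ↦ chartAt (EuclideanSpace ℝ (Fin d)) p p + s • v) 0 := by
      fun_prop
    exact this.eventually_mem (by simpa using Metric.ball_mem_nhds _ hρ)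
  have h2 := h1.and ((tendsto_displacement p v).eventually_mem hU)
  obtain ⟨s, ⟨hs1, hs2⟩, hs⟩ := ((h2.filter_mono nhdsWithin_le_nhds).and
    (self_mem_nhdsWithin (s := Ioi (0 : ℝ)))).exists
  refine ⟨_, hs2, ?_⟩
  have := h _ (Metric.mem_ball_self hρ) s hs hs1
  rwa [(chartAt (EuclideanSpace ℝ (Fin d)) p).left_inv (mem_chart_source _ p)] at this

lemma exists_chron_left_mem (S : Spacetime d M) {U : Set M} (hU : U ∈ 𝓝 p) :
    ∃ q ∈ U, S.Chron q p := by
  obtain ⟨v, ρ, hρ, -, h⟩ := exists_displacement S p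
  have h1 : ∀ᶠ s : ℝ in 𝓝 0, chartAt (EuclideanSpace ℝ (Fin d)) p p + s • (-v) ∈
      Metric.ball (chartAt (EuclideanSpace ℝ (Fin d)) p p) ρ := by
    have : ContinuousAt (fun s : ℝ ↦ chartAt (EuclideanSpace ℝ (Fin d)) p p + s • (-v)) 0 := by
      fun_prop
    exact this.eventually_mem (by simpa using Metric.ball_mem_nhds _ hρ)
  have h2 := h1.and ((tendsto_displacement p (-v)).eventually_mem hU)
  obtain ⟨s, ⟨hs1, hs2⟩, hs⟩ := ((h2.filter_mono nhdsWithin_le_nhds).and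
    (self_mem_nhdsWithin (s := Ioi (0 : ℝ)))).exists
  refine ⟨_, hs2, ?_⟩
  have := h _ hs1 s hs (by
    rw [smul_neg, neg_add_cancel_right]
    exact Metric.mem_ball_self hρ)
  simp only [smul_neg, neg_add_cancel_right] at this
  rw [(chartAt (EuclideanSpace ℝ (Fin d)) p).left_inv (mem_chart_source _ p)] at this
  simpa using this

end Openness

/-! ### Closed coordinate balls -/

section CoordBall

variable {d : ℕ} {M : Type*} [TopologicalSpace M]
  [ChartedSpace (EuclideanSpace ℝ (Fin d)) M]

/-- The closed coordinate ball of radius `r` about `p`, in the preferred chart at `p`. -/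
def coordBall (p : M) (r : ℝ) : Set M :=
  (chartAt (EuclideanSpace ℝ (Fin d)) p).symm ''
    Metric.closedBall (chartAt (EuclideanSpace ℝ (Fin d)) p p) r

lemma coordBall_mem_nhds (p : M) {ρ : ℝ} (hρ : 0 < ρ) :
    coordBall (d := d) p ρ ∈ 𝓝 p := by
  set e := chartAt (EuclideanSpace ℝ (Fin d)) p with he_def
  have hp : p ∈ e.source := mem_chart_source _ p
  filter_upwards [(e.continuousAt hp).preimage_mem_nhds (Metric.closedBall_mem_nhds _ hρ),
    e.open_source.mem_nhds hp] with y hy hy'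
  exact ⟨e y, hy, e.left_inv hy'⟩

end CoordBall

/-! ### The causal order and push-up -/

section CausalLE

variable {d : ℕ} {M : Type*} [TopologicalSpace M]
  [ChartedSpace (EuclideanSpace ℝ (Fin d)) M] [IsManifold (𝓡 d) ∞ M]
  {S : Spacetime d M} {p q r x y z : M} {γ : ℝ → M} {a b : ℝ}

/-- The order relation between points that compares their chronological pasts and futures. -/
def CausalLE (S : Spacetime d M) (p q : M) : Prop :=
  (∀ a, S.Chron a p → S.Chron a q) ∧ ∀ a, S.Chron q a → S.Chron p a

lemma CausalLE.refl (S : Spacetime d M) (p : M) : S.CausalLE p p := ⟨fun _ h ↦ h, fun _ h ↦ h⟩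

lemma CausalLE.trans (h : S.CausalLE p q) (h' : S.CausalLE q r) : S.CausalLE p r :=
  ⟨fun a ha ↦ h'.1 a (h.1 a ha), fun a ha ↦ h.2 a (h'.2 a ha)⟩

/-- A future-directed causal curve in `B` leads from `x` to `y`. -/
def CausallyJoinedIn (S : Spacetime d M) (B : Set M) (x y : M) : Prop :=
  ∃ (γ : ℝ → M) (a b : ℝ), PiecewiseArc S.FutureCausal γ a b ∧ γ a = x ∧ γ b = y ∧
    ∀ t ∈ Icc a b, γ t ∈ B

lemma CausallyJoinedIn.left_mem {B : Set M} (h : S.CausallyJoinedIn B x y) : x ∈ B := by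
  obtain ⟨γ, a, b, h, rfl, rfl, hB⟩ := h
  exact hB _ (left_mem_Icc.2 h.lt.le)

lemma CausallyJoinedIn.right_mem {B : Set M} (h : S.CausallyJoinedIn B x y) : y ∈ B := by
  obtain ⟨γ, a, b, h, rfl, rfl, hB⟩ := h
  exact hB _ (right_mem_Icc.2 h.lt.le)

lemma CausallyJoinedIn.mono {B B' : Set M} (h : S.CausallyJoinedIn B x y) (hB : B ⊆ B') :
    S.CausallyJoinedIn B' x y := by
  obtain ⟨γ, a, b, h, hx, hy, h'⟩ := h
  exact ⟨γ, a, b, h, hx, hy, fun t ht ↦ hB (h' t ht)⟩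

/-- In small coordinate balls the closure of the causal relation implies the causal order. -/
lemma exists_coordBall_causalLE [T2Space M] (S : Spacetime d M) (p : M) :
    ∃ ρ > 0, Metric.closedBall (chartAt (EuclideanSpace ℝ (Fin d)) p p) ρ ⊆
        (chartAt (EuclideanSpace ℝ (Fin d)) p).target ∧
      ∀ r q, (r, q) ∈ closure {a : M × M | S.CausallyJoinedIn (coordBall (d := d) p ρ) a.1 a.2} →
        S.CausalLE r q := by
  obtain ⟨w, h, ρ, hρ, κ, hκ, η₀, hη₀, hsub, hshear⟩ := exists_shear S p
  refine ⟨ρ, hρ, hsub, fun r q hrq ↦ ?_⟩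
  unfold coordBall at hrq
  set e := chartAt (EuclideanSpace ℝ (Fin d)) p with he_def
  have he : e ∈ atlas (EuclideanSpace ℝ (Fin d)) M := chart_mem_atlas _ p
  set K := Metric.closedBall (e p) ρ with hK
  have hBs : e.symm '' K ⊆ e.source := by
    rintro _ ⟨x, hx, rfl⟩
    exact e.map_target (hsub hx)
  have hBK : ∀ y ∈ e.symm '' K, e y ∈ K := by
    rintro _ ⟨x, hx, rfl⟩
    rwa [e.right_inv (hsub hx)]
  have hBc : IsClosed (e.symm '' K) :=
    ((isCompact_closedBall _ _).image_of_continuousOn (e.continuousOn_symm.mono hsub)).isClosed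
  have hmem : (r, q) ∈ (e.symm '' K) ×ˢ (e.symm '' K) :=
    closure_minimal (t := (e.symm '' K) ×ˢ (e.symm '' K))
      (fun a ha ↦ ⟨CausallyJoinedIn.left_mem ha, CausallyJoinedIn.right_mem ha⟩)
      (hBc.prod hBc) hrq
  -- shearing a causal curve
  have hchron : ∀ r' q', S.CausallyJoinedIn (e.symm '' K) r' q' → ∀ s ∈ K, ∀ u η, 0 < η → η ≤ η₀ →
      ‖u‖ ≤ κ * η → S.Chron (e.symm (e r' + u + (η * (h (e r') - h s)) • w))
        (e.symm (e q' + u + (η * (h (e q') - h s)) • w)) := by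
    rintro r' q' ⟨γ, a, b, hγ, rfl, rfl, hB⟩ s hs u η hη hη' hu
    have hd : ∀ x, HasFDerivAt (fun x ↦ x + u + (η * (h x - h s)) • w)
        (ContinuousLinearMap.id ℝ (EuclideanSpace ℝ (Fin d)) + (η • h).smulRight w) x := by
      intro x
      have h1 : HasFDerivAt (fun x ↦ η * (h x - h s)) (η • h) x :=
        (h.hasFDerivAt.sub_const (h s)).const_mul η
      exact ((hasFDerivAt_id x).add_const u).add (h1.smul_const w)
    refine (PiecewiseArc.map_coord (Q := S.FutureTimelike) he
      (Φ := fun x ↦ x + u + (η * (h x - h s)) • w) (by fun_prop) (K := K)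
      (fun x hx ↦ ?_) hγ fun t ht ↦ ⟨hBs (hB t ht), hBK _ (hB t ht)⟩).chron
    obtain ⟨h1, h2⟩ := hshear x hx s hs u η hη hη' hu
    refine ⟨h1, fun v hv ↦ ?_⟩
    rw [(hd x).fderiv]
    exact h2 v hv
  -- choice of the parameters
  have hparam : ∀ δ > 0, ∃ η > 0, η ≤ η₀ ∧ ∃ r' q', S.CausallyJoinedIn (e.symm '' K) r' q' ∧
      ‖e r - e r'‖ ≤ κ * η ∧ ‖e q - e q'‖ ≤ κ * η ∧ ∀ x ∈ K, ∀ s ∈ K,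
        ‖e r' - e r‖ + ‖e q' - e q‖ + ‖(η * (h x - h s)) • w‖ < δ := by
    intro δ hδ
    set C := ‖h‖ * (2 * ρ) * ‖w‖ with hC
    have hC0 : 0 ≤ C := by positivity
    set η := min η₀ (δ / (2 * (C + 1))) with hη
    have hη0 : 0 < η := lt_min hη₀ (by positivity)
    -- The order of choice matters: `η` is fixed by the size of the shear alone, and the
    -- approximating pair is then taken within `κ * η`, so that the translation moving one of its
    -- points onto the limit is admissible.
    set δ' := min (κ * η) (δ / 4) with hδ'
    have hδ'0 : 0 < δ' := lt_min (by positivity) (by positivity)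
    have h1 : ∀ᶠ a : M × M in 𝓝 (r, q), dist (e a.1) (e r) < δ' ∧ dist (e a.2) (e q) < δ' := by
      refine Eventually.and ?_ ?_
      · exact (ContinuousAt.comp (x := (r, q)) (e.continuousAt (hBs hmem.1))
          continuousAt_fst).eventually_mem (Metric.ball_mem_nhds _ hδ'0)
      · exact (ContinuousAt.comp (x := (r, q)) (e.continuousAt (hBs hmem.2))
          continuousAt_snd).eventually_mem (Metric.ball_mem_nhds _ hδ'0)
    obtain ⟨⟨r', q'⟩, h2, h3, h4⟩ := ((mem_closure_iff_frequently.1 hrq).and_eventually h1).exists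
    rw [dist_eq_norm] at h3 h4
    refine ⟨η, hη0, min_le_left _ _, r', q', h2, ?_, ?_, fun x hx s hs ↦ ?_⟩
    · rw [norm_sub_rev]
      exact h3.le.trans (min_le_left _ _)
    · rw [norm_sub_rev]
      exact h4.le.trans (min_le_left _ _)
    · have h5 : |h x - h s| ≤ ‖h‖ * (2 * ρ) := by
        rw [← map_sub, ← Real.norm_eq_abs]
        refine (h.le_opNorm _).trans ?_
        gcongr
        rw [← dist_eq_norm]
        linarith [dist_triangle_right x s (e p), Metric.mem_closedBall.1 hx,
          Metric.mem_closedBall.1 hs]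
      have h6 : ‖(η * (h x - h s)) • w‖ ≤ η * C := by
        rw [norm_smul, Real.norm_eq_abs, abs_mul, abs_of_pos hη0, hC, mul_assoc]
        gcongr
      have h7 : η * (2 * (C + 1)) ≤ δ := by
        rw [← le_div_iff₀ (by positivity)]
        exact min_le_right _ _
      have h8 : δ' ≤ δ / 4 := min_le_right _ _
      nlinarith
  have hconv : ∀ z ∈ e.symm '' K, ∀ O ∈ 𝓝 z, ∃ δ > 0, ∀ x, ‖x - e z‖ < δ → e.symm x ∈ O := by
    intro z hz O hO
    have h1 : ContinuousAt e.symm (e z) := e.continuousAt_symm (e.map_source (hBs hz))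
    have h2 : e.symm ⁻¹' O ∈ 𝓝 (e z) := h1.preimage_mem_nhds (by rwa [e.left_inv (hBs hz)])
    obtain ⟨δ, hδ, h3⟩ := Metric.mem_nhds_iff.1 h2
    exact ⟨δ, hδ, fun x hx ↦ h3 (by rwa [Metric.mem_ball, dist_eq_norm])⟩
  constructor
  · intro a ha
    obtain ⟨δ, hδ, hO⟩ := hconv r hmem.1 _ ha.eventually_right
    obtain ⟨η, hη, hη', r', q', hj, hr, hq, hlt⟩ := hparam δ hδ
    -- The shear is anchored at `q'` and translated so that `q'` lands exactly on `q`, while `r'`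
    -- lands close to `r`, hence still in the open future of `a`.
    have h1 := hchron r' q' hj (e q') (hBK _ hj.right_mem) (e q - e q') η hη hη' hq
    have h2 : e q' + (e q - e q') + (η * (h (e q') - h (e q'))) • w = e q := by simp
    rw [h2, e.left_inv (hBs hmem.2)] at h1
    refine ChronologicalIn.trans (hO _ ?_) h1
    have h3 : e r' + (e q - e q') + (η * (h (e r') - h (e q'))) • w - e r =
        (e r' - e r) - (e q' - e q) + (η * (h (e r') - h (e q'))) • w := by abel
    rw [h3]
    refine ((norm_add_le _ _).trans (add_le_add_left (norm_sub_le _ _) _)).trans_lt ?_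
    exact hlt _ (hBK _ hj.left_mem) _ (hBK _ hj.right_mem)
  · intro a ha
    obtain ⟨δ, hδ, hO⟩ := hconv q hmem.2 _ ha.eventually_left
    obtain ⟨η, hη, hη', r', q', hj, hr, hq, hlt⟩ := hparam δ hδ
    -- Now the initial point is anchored and lands exactly on `r`.
    have h1 := hchron r' q' hj (e r') (hBK _ hj.left_mem) (e r - e r') η hη hη' hr
    have h2 : e r' + (e r - e r') + (η * (h (e r') - h (e r'))) • w = e r := by simp
    rw [h2, e.left_inv (hBs hmem.1)] at h1
    refine ChronologicalIn.trans h1 (hO _ ?_)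
    have h3 : e q' + (e r - e r') + (η * (h (e q') - h (e r'))) • w - e q =
        (e q' - e q) - (e r' - e r) + (η * (h (e q') - h (e r'))) • w := by abel
    rw [h3]
    refine ((norm_add_le _ _).trans (add_le_add_left (norm_sub_le _ _) _)).trans_lt ?_
    rw [add_comm ‖e q' - e q‖]
    exact hlt _ (hBK _ hj.right_mem) _ (hBK _ hj.left_mem)

/-- The push-up property of the causal relation. -/
lemma PiecewiseArc.causalLE [T2Space M] (h : PiecewiseArc S.FutureCausal γ a b) :
    S.CausalLE (γ a) (γ b) := by
  choose ρ hρ _ hle using fun p : M ↦ exists_coordBall_causalLE S p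
  have hcont : Continuous (fun t : Icc a b ↦ γ t) :=
    continuousOn_iff_continuous_domRestrict.1 h.continuousOn
  -- Compactness of the interval cuts the curve into finitely many pieces, each inside one good
  -- coordinate ball; transitivity of the order joins them.
  obtain ⟨t, ht0, hmono, ⟨m, hm⟩, ht⟩ := exists_monotone_Icc_subset_open_cover_Icc h.lt.le
    (c := fun p : M ↦ (fun t : Icc a b ↦ γ t) ⁻¹' interior (coordBall (d := d) p (ρ p)))
    (fun p ↦ isOpen_interior.preimage hcont)
    (fun t _ ↦ mem_iUnion.2 ⟨γ t, mem_interior_iff_mem_nhds.2 (coordBall_mem_nhds _ (hρ _))⟩)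
  have key : ∀ n, S.CausalLE (γ a) (γ (t n)) := by
    intro n
    induction n with
    | zero => rw [ht0]; exact .refl S _
    | succ n ih =>
      refine ih.trans ?_
      rcases (hmono n.le_succ).eq_or_lt with heq | hlt
      · rw [heq]; exact .refl S _
      · obtain ⟨p, hp⟩ := ht n
        refine hle p _ _ (subset_closure ?_)
        have h1 : (a : ℝ) ≤ t n := (t n).2.1
        have h2 : (t (n + 1) : ℝ) ≤ b := (t (n + 1)).2.2
        exact ⟨γ, t n, t (n + 1), h.mono h1 hlt h2, rfl, rfl, fun u hu ↦ interior_subset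
          (hp (show (⟨u, h1.trans hu.1, hu.2.trans h2⟩ : Icc a b) ∈ Icc (t n) (t (n + 1)) from hu))⟩
  have := key m
  rwa [hm m le_rfl] at this

lemma StrictlyCausal.causalLE [T2Space M] (h : S.StrictlyCausal x y) : S.CausalLE x y := by
  obtain ⟨γ, a, b, hab, hγ, rfl, rfl⟩ := h
  exact (hγ.piecewiseArc (left_mem_Icc.2 hab.le) (right_mem_Icc.2 hab.le) hab).causalLE

end CausalLE

end Spacetime

/-! ### Sequences without limit -/

/-- A greedy choice of large steps produces a sequence without limit. -/
lemma exists_seq_forall_not_tendsto {X : Type*} [TopologicalSpace X]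
    [TopologicalSpace.MetrizableSpace X] {R : X → X → Prop} {P : X → Prop} {x : X} (hx : P x)
    (h : ∀ p, ∃ C, IsClosed C ∧ p ∉ C ∧ ∀ᶠ q in 𝓝 p, P q → ∃ r ∈ C, R q r ∧ P r) :
    ∃ q : ℕ → X, q 0 = x ∧ (∀ n, P (q n)) ∧ (∀ n, R (q n) (q (n + 1))) ∧
      ∀ p, ¬ Tendsto q atTop (𝓝 p) := by
  classical
  let _ := TopologicalSpace.metrizableSpaceMetric X
  have h1 : ∀ p, ∃ n : ℕ, ∀ᶠ q in 𝓝 p, P q → ∃ r, R q r ∧ P r ∧ (1 / 2 : ℝ) ^ n ≤ dist q r := by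
    intro p
    obtain ⟨C, hC, hpC, hp⟩ := h p
    obtain ⟨ε, hε, hball⟩ := Metric.mem_nhds_iff.1 (hC.isOpen_compl.mem_nhds hpC)
    obtain ⟨n, hn⟩ := exists_pow_lt_of_lt_one (half_pos hε) (by norm_num : (1 / 2 : ℝ) < 1)
    refine ⟨n, ?_⟩
    filter_upwards [hp, Metric.ball_mem_nhds p (half_pos hε)] with q hq hqp hPq
    obtain ⟨r, hrC, hr1, hr2⟩ := hq hPq
    refine ⟨r, hr1, hr2, hn.le.trans ?_⟩
    have h2 : ε ≤ dist r p := by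
      by_contra! hcon
      exact hball hcon hrC
    linarith [dist_triangle_left r p q, Metric.mem_ball.1 hqp]
  have h2 : ∀ q : {q // P q}, ∃ r : {q // P q}, R q r ∧
      ∀ (n : ℕ) (r' : X), R q r' → P r' → (1 / 2 : ℝ) ^ n ≤ dist (q : X) r' →
        (1 / 2 : ℝ) ^ n ≤ dist (q : X) r := by
    rintro ⟨q, hq⟩
    have hex : ∃ n : ℕ, ∃ r, R q r ∧ P r ∧ (1 / 2 : ℝ) ^ n ≤ dist q r := by
      obtain ⟨n, hn⟩ := h1 q
      exact ⟨n, hn.self_of_nhds hq⟩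
    -- The least `n` gives a longest available step up to a factor of two. Near a limit point the
    -- steps would then stay bounded below, whereas the steps of a convergent sequence tend to zero.
    obtain ⟨r, hr1, hr2, hr3⟩ := Nat.find_spec hex
    refine ⟨⟨r, hr2⟩, hr1, fun n r' h3 h4 h5 ↦ le_trans ?_ hr3⟩
    exact pow_le_pow_of_le_one (by norm_num) (by norm_num) (Nat.find_min' hex ⟨r', h3, h4, h5⟩)
  choose f hf1 hf2 using h2
  let q : ℕ → {q // P q} := fun n ↦ f^[n] ⟨x, hx⟩
  have hq : ∀ n, q (n + 1) = f (q n) := fun n ↦ Function.iterate_succ_apply' f n _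
  refine ⟨fun n ↦ q n, rfl, fun n ↦ (q n).2, fun n ↦ ?_, fun p hp ↦ ?_⟩
  · have := hf1 (q n)
    rwa [← hq] at this
  · obtain ⟨n, hn⟩ := h1 p
    have h3 : ∀ᶠ k in atTop, (1 / 2 : ℝ) ^ n ≤ dist (q k : X) (q (k + 1)) := by
      filter_upwards [hp.eventually hn] with k hk
      obtain ⟨r, h4, h5, h6⟩ := hk (q k).2
      rw [hq]
      exact hf2 _ n r h4 h5 h6
    have h4 : Tendsto (fun k ↦ dist (q k : X) (q (k + 1))) atTop (𝓝 (dist p p)) :=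
      hp.dist (hp.comp (tendsto_add_atTop_nat 1))
    have h5 := ge_of_tendsto h4 h3
    rw [dist_self] at h5
    exact absurd h5 (not_le.2 (by positivity))

namespace Spacetime

/-! ### Limit curve arguments -/

section LimitCurves

variable {d : ℕ} {M : Type*} [TopologicalSpace M]
  [ChartedSpace (EuclideanSpace ℝ (Fin d)) M] [IsManifold (𝓡 d) ∞ M]
  {S : Spacetime d M} {p q r x y z : M} {γ : ℝ → M} {a b : ℝ}

/-- A chronological sequence to the past without limit lies on a past-inextendible timelike
curve. -/
lemma exists_pastInextendible_of_seq {w : ℕ → M} (hw : ∀ n, S.Chron (w (n + 1)) (w n))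
    (hlim : ∀ p, ¬ Tendsto w atTop (𝓝 p)) :
    ∃ γ : ℝ → M, S.IsTimelikeCurve γ (Iic 0) ∧ PastInextendible γ (Iic 0) ∧
      ∀ n : ℕ, γ (-n) = w n := by
  have h1 : ∀ n : ℕ, ∃ σ, PiecewiseArc S.FutureTimelike σ (-(n + 1 : ℝ)) (-n) ∧
      σ (-(n + 1 : ℝ)) = w (n + 1) ∧ σ (-n) = w n := fun n ↦ by
    obtain ⟨σ, h2, h3, h4, -⟩ := (hw n).exists_piecewiseArc
      (a := -(n + 1 : ℝ)) (b := -n) (by linarith)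
    exact ⟨σ, h2, h3, h4⟩
  choose σ hσ hσ1 hσ2 using h1
  set γ : ℝ → M := fun t ↦ σ ⌊-t⌋₊ t with hγ
  have hγn : ∀ n : ℕ, γ (-n) = w n := fun n ↦ by
    simp only [hγ, neg_neg, Nat.floor_natCast]
    exact hσ2 n
  have heq : ∀ n : ℕ, EqOn γ (σ n) (Icc (-(n + 1 : ℝ)) (-n)) := by
    intro n t ht
    -- At the left end of the interval the floor is already `n + 1`, so the value comes from the
    -- next piece; both pieces take the value `w (n + 1)` there.
    rcases ht.1.eq_or_lt with h | h
    · rw [← h, hσ1]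
      exact_mod_cast hγn (n + 1)
    · have : ⌊-t⌋₊ = n := by
        rw [Nat.floor_eq_iff (by linarith [ht.2, (Nat.cast_nonneg n : (0 : ℝ) ≤ n)])]
        constructor <;> linarith [ht.2]
      simp only [hγ, this]
  have hpw : ∀ n : ℕ, PiecewiseArc S.FutureTimelike γ (-(n + 1 : ℝ)) 0 := by
    intro n
    induction n with
    | zero => simpa using (hσ 0).congr (heq 0)
    | succ n ih =>
      refine .trans ((hσ (n + 1)).congr (heq (n + 1))) ?_
      exact_mod_cast ih
  refine ⟨γ, isPiecewiseCurve_iff.2 ⟨ordConnected_Iic, ⟨-1, by simp, 0, by simp, by simp⟩,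
    fun a _ b hb hab ↦ ?_⟩, ?_, hγn⟩
  · obtain ⟨n, hn⟩ := exists_nat_gt (-a)
    exact (hpw n).mono (by linarith) hab hb
  · rintro ⟨p, hp⟩
    have h2 : Tendsto (fun n : ℕ ↦ (⟨-n, by simp⟩ : Iic (0 : ℝ))) atTop atBot := by
      refine tendsto_atBot.2 fun b ↦ ?_
      obtain ⟨N, hN⟩ := exists_nat_gt (-(b : ℝ))
      filter_upwards [eventually_ge_atTop N] with n hn
      have : (N : ℝ) ≤ n := by exact_mod_cast hn
      exact Subtype.coe_le_coe.1 (by simp only; linarith)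
    refine hlim p ((hp.comp h2).congr fun n ↦ ?_)
    exact hγn n

/-- A timelike curve that leads into an open set `V` and is not contained in the closure of `V`
enters `V` through its frontier. -/
lemma Chron.exists_exit {V : Set M} (hV : IsOpen V) (h : S.Chron x y) (hy : y ∈ V)
    (hxy : ¬ S.CausallyJoinedIn (closure V) x y) :
    ∃ s ∈ closure V \ V, S.Chron x s ∧ S.CausallyJoinedIn (closure V) s y := by
  obtain ⟨γ, hγ, rfl, rfl, -⟩ := h.exists_piecewiseArc (a := 0) (b := 1) one_pos
  have hcausal : PiecewiseArc S.FutureCausal γ 0 1 := hγ.imp fun _ _ h ↦ h.futureCausal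
  set A := Icc (0 : ℝ) 1 ∩ γ ⁻¹' Vᶜ with hA
  have hAc : IsClosed A := hγ.continuousOn.preimage_isClosed_of_isClosed isClosed_Icc
    hV.isClosed_compl
  have hAne : A.Nonempty := by
    by_contra hcon
    rw [not_nonempty_iff_eq_empty] at hcon
    refine hxy ⟨γ, 0, 1, hcausal, rfl, rfl, fun t ht ↦ subset_closure ?_⟩
    by_contra htV
    have : t ∈ A := ⟨ht, htV⟩
    rw [hcon] at this
    exact this
  have hAcomp : IsCompact A := isCompact_Icc.of_isClosed_subset hAc inter_subset_left
  -- The last parameter outside `V`: from there on the curve stays in the closure of `V`.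
  set t := sSup A with ht_def
  have ht : t ∈ A := hAcomp.sSup_mem hAne
  have ht1 : t < 1 := by
    refine lt_of_le_of_ne ht.1.2 fun h1 ↦ ht.2 ?_
    rw [h1]
    exact hy
  have hafter : ∀ u ∈ Ioc t 1, γ u ∈ V := by
    intro u hu
    by_contra huV
    exact hu.1.not_ge (le_csSup hAcomp.bddAbove ⟨⟨ht.1.1.trans hu.1.le, hu.2⟩, huV⟩)
  have htV : γ t ∈ closure V := by
    have h1 : ContinuousWithinAt γ (Ioc t 1) t :=
      (hγ.continuousOn t ht.1).mono fun u hu ↦ ⟨ht.1.1.trans hu.1.le, hu.2⟩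
    refine h1.mem_closure ?_ hafter
    rw [closure_Ioc ht1.ne]
    exact left_mem_Icc.2 ht1.le
  have hin : ∀ u ∈ Icc t 1, γ u ∈ closure V := by
    intro u hu
    rcases hu.1.eq_or_lt with h | h
    · rwa [← h]
    · exact subset_closure (hafter u ⟨h, hu.2⟩)
  have ht0 : 0 < t := by
    refine lt_of_le_of_ne ht.1.1 fun h0 ↦ hxy ?_
    exact ⟨γ, 0, 1, hcausal, rfl, rfl, fun u hu ↦ hin u (h0 ▸ hu)⟩
  exact ⟨γ t, ⟨htV, ht.2⟩, (hγ.mono le_rfl ht0 ht1.le).chron,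
    γ, t, 1, hcausal.mono ht0.le ht1 le_rfl, rfl, rfl, hin⟩

/-- The local step of the limit curve construction: if `(z, q)` is a limit of chronologically
related pairs, then either `z` precedes `q`, or there is such a pair `(z, r)` with `r` before `q`
and away from `q`. -/
lemma exists_limit_step [T2Space M] (S : Spacetime d M) (z p : M) : ∃ C, IsClosed C ∧ p ∉ C ∧
    ∀ᶠ q in 𝓝 p, (z, q) ∈ closure {a : M × M | S.Chron a.1 a.2} → S.CausalLE z q ∨
      ∃ r ∈ C, S.CausalLE r q ∧ (z, r) ∈ closure {a : M × M | S.Chron a.1 a.2} := by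
  obtain ⟨ρ, hρ, hsub, hle⟩ := exists_coordBall_causalLE S p
  unfold coordBall at hle
  set e := chartAt (EuclideanSpace ℝ (Fin d)) p with he_def
  have hp : p ∈ e.source := mem_chart_source _ p
  set V := e.source ∩ e ⁻¹' Metric.ball (e p) ρ with hV
  have hVo : IsOpen V := e.isOpen_inter_preimage Metric.isOpen_ball
  have hBcomp : IsCompact (e.symm '' Metric.closedBall (e p) ρ) :=
    (isCompact_closedBall _ _).image_of_continuousOn (e.continuousOn_symm.mono hsub)
  have hVB : closure V ⊆ e.symm '' Metric.closedBall (e p) ρ := by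
    refine closure_minimal (fun y hy ↦ ?_) hBcomp.isClosed
    exact ⟨e y, Metric.ball_subset_closedBall hy.2, e.left_inv hy.1⟩
  have hCcomp : IsCompact (closure V \ V) :=
    (hBcomp.of_isClosed_subset isClosed_closure hVB).diff hVo
  have hpV : p ∈ V := ⟨hp, Metric.mem_ball_self hρ⟩
  refine ⟨closure V \ V, hCcomp.isClosed, fun h ↦ h.2 hpV, ?_⟩
  filter_upwards [hVo.mem_nhds hpV] with q hq hzq
  -- Either the approximating pairs can be joined inside the small ball, where limits are already
  -- controlled, or every timelike curve between nearby pairs ending in `V` crosses the compact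
  -- frontier of `V`.
  by_cases hcl : (z, q) ∈ closure {a : M × M | S.CausallyJoinedIn (closure V) a.1 a.2}
  · exact Or.inl (hle _ _ (closure_mono (fun a ha ↦ CausallyJoinedIn.mono ha hVB) hcl))
  right
  have h1 : ∀ᶠ a : M × M in 𝓝 (z, q), ¬ S.CausallyJoinedIn (closure V) a.1 a.2 := by
    rw [mem_closure_iff_frequently, not_frequently] at hcl
    exact hcl
  have h2 : ∀ᶠ a : M × M in 𝓝 (z, q), a.2 ∈ V :=
    continuousAt_snd.eventually_mem (hVo.mem_nhds hq)
  have h3 : ∃ᶠ a : M × M in 𝓝 (z, q), ∃ s, s ∈ closure V \ V ∧ S.Chron a.1 s ∧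
      S.CausallyJoinedIn (closure V) s a.2 := by
    refine ((mem_closure_iff_frequently.1 hzq).and_eventually (h1.and h2)).mono ?_
    rintro a ⟨h4, h5, h6⟩
    obtain ⟨s, hs, hs1, hs2⟩ := Chron.exists_exit hVo h4 h6 h5
    exact ⟨s, hs, hs1, hs2⟩
  set A := {a : M × M | ∃ s, s ∈ closure V \ V ∧ S.Chron a.1 s ∧
      S.CausallyJoinedIn (closure V) s a.2} with hA
  have : (𝓝 (z, q) ⊓ 𝓟 A).NeBot := frequently_mem_iff_neBot.1 h3
  have hex : ∀ a : M × M, ∃ s, a ∈ A → s ∈ closure V \ V ∧ S.Chron a.1 s ∧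
      S.CausallyJoinedIn (closure V) s a.2 := fun a ↦ by
    by_cases ha : a ∈ A
    · obtain ⟨s, hs⟩ := ha
      exact ⟨s, fun _ ↦ hs⟩
    · exact ⟨a.1, fun h ↦ absurd h ha⟩
  choose s hs using hex
  have hAev : ∀ᶠ a in 𝓝 (z, q) ⊓ 𝓟 A, a ∈ A := mem_inf_of_right (mem_principal_self A)
  have hmap : map s (𝓝 (z, q) ⊓ 𝓟 A) ≤ 𝓟 (closure V \ V) :=
    tendsto_principal.2 (hAev.mono fun a ha ↦ (hs a ha).1)
  -- A cluster point of the last entry points: it is a limit of points reached from near `z`, and a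
  -- limit of starting points of local causal curves to near `q`.
  obtain ⟨r, hrC, hr⟩ := hCcomp hmap
  have hfreq : ∀ O ∈ 𝓝 r, ∀ O' ∈ 𝓝 (z, q), ∃ a ∈ O', s a ∈ O ∧ a ∈ A := by
    intro O hO O' hO'
    have h4 : ∃ᶠ a in 𝓝 (z, q) ⊓ 𝓟 A, s a ∈ O := mapClusterPt_iff_frequently.1 hr O hO
    have h5 : ∀ᶠ a in 𝓝 (z, q) ⊓ 𝓟 A, a ∈ O' := mem_inf_of_left hO'
    obtain ⟨a, h6, h7, h8⟩ := (h4.and_eventually (h5.and hAev)).exists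
    exact ⟨a, h7, h6, h8⟩
  refine ⟨r, hrC, hle _ _ ?_, ?_⟩
  · refine mem_closure_iff_nhds.2 fun t ht ↦ ?_
    obtain ⟨u, hu, v, hv, huv⟩ := mem_nhds_prod_iff.1 ht
    obtain ⟨a, h4, h5, h6⟩ := hfreq u hu (univ ×ˢ v) (prod_mem_nhds univ_mem hv)
    exact ⟨(s a, a.2), huv ⟨h5, h4.2⟩, (hs a h6).2.2.mono hVB⟩
  · refine mem_closure_iff_nhds.2 fun t ht ↦ ?_
    obtain ⟨u, hu, v, hv, huv⟩ := mem_nhds_prod_iff.1 ht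
    obtain ⟨a, h4, h5, h6⟩ := hfreq v hv (u ×ˢ univ) (prod_mem_nhds hu univ_mem)
    exact ⟨(a.1, s a), huv ⟨h4.1, h5⟩, (hs a h6).2.1⟩

end LimitCurves

/-! ### Volume of open sets and of achronal sets -/

section Volume

variable {d : ℕ} {M : Type*} [TopologicalSpace M]
  [ChartedSpace (EuclideanSpace ℝ (Fin d)) M] [IsManifold (𝓡 d) ∞ M]
  {S : Spacetime d M} {p q r x y z : M}

/-- The matrix of the metric in the coordinates of the chart `e`. -/
def coordMatrix (S : Spacetime d M) (e : OpenPartialHomeomorph M (EuclideanSpace ℝ (Fin d)))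
    (y : EuclideanSpace ℝ (Fin d)) : Matrix (Fin d) (Fin d) ℝ :=
  Matrix.of fun i j ↦ S.coordMetric e y (EuclideanSpace.single i 1) (EuclideanSpace.single j 1)

/-- A kernel vector would be orthogonal to everything, in particular to itself and to the timelike
vector on whose orthogonal complement the metric is positive definite. -/
lemma det_coordMatrix_ne_zero (S : Spacetime d M)
    {e : OpenPartialHomeomorph M (EuclideanSpace ℝ (Fin d))}
    (he : e ∈ atlas (EuclideanSpace ℝ (Fin d)) M) {y : EuclideanSpace ℝ (Fin d)}
    (hy : y ∈ e.target) : (S.coordMatrix e y).det ≠ 0 := by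
  intro h0
  obtain ⟨v, hv, hv0⟩ := Matrix.exists_mulVec_eq_zero_iff.2 h0
  set w : EuclideanSpace ℝ (Fin d) := ∑ j, v j • EuclideanSpace.single j (1 : ℝ) with hw
  have hwv : ∀ i, w i = v i := fun i ↦ by
    simp [hw, Finset.sum_apply, Pi.single_apply]
  have h1 : ∀ i, S.coordMetric e y (EuclideanSpace.single i 1) w = 0 := fun i ↦ by
    have := congrFun hv0 i
    simp only [Matrix.mulVec, dotProduct, coordMatrix, Matrix.of_apply, Pi.zero_apply] at this
    rw [← this, hw, map_sum]
    exact Finset.sum_congr rfl fun j _ ↦ by rw [map_smul, smul_eq_mul, mul_comm]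
  have h2 : ∀ u, S.coordMetric e y u w = 0 := fun u ↦ by
    have h3 : u = ∑ i, u i • EuclideanSpace.single i (1 : ℝ) := by
      ext j
      simp [Finset.sum_apply, Pi.single_apply]
    rw [S.coordMetric_symm, h3, map_sum]
    exact Finset.sum_eq_zero fun i _ ↦ by rw [map_smul, S.coordMetric_symm, h1, smul_zero]
  obtain ⟨u, -, hu⟩ := S.coordMetric_signature he hy
  have hw0 : w ≠ 0 := fun h ↦ hv (funext fun i ↦ by rw [← hwv, h]; rfl)
  exact (hu w (h2 u) hw0).ne' (h2 w)

lemma continuousAt_coordMatrix (S : Spacetime d M)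
    {e : OpenPartialHomeomorph M (EuclideanSpace ℝ (Fin d))}
    (he : e ∈ atlas (EuclideanSpace ℝ (Fin d)) M) {y : EuclideanSpace ℝ (Fin d)}
    (hy : y ∈ e.target) : ContinuousAt (S.coordMatrix e) y := by
  refine continuousAt_pi.2 fun i ↦ continuousAt_pi.2 fun j ↦ ?_
  exact ((S.contDiffAt_coordMetric he hy).continuousAt.clm_apply continuousAt_const).clm_apply
    continuousAt_const

variable [MeasurableSpace M]

lemma cosmologicalVolume_mono (h : ∀ a, S.Chron a x → S.Chron a y) :
    S.cosmologicalVolume x ≤ S.cosmologicalVolume y :=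
  measure_mono fun a ha ↦ h a ha

variable [BorelSpace M]

/-- In a chart the density is continuous and nonzero at the chosen point, hence bounded below by a
positive constant nearby. -/
lemma volumeMeasure_pos_of_isOpen (S : Spacetime d M) {U : Set M} (hU : IsOpen U)
    (hne : U.Nonempty) : 0 < S.volumeMeasure U := by
  obtain ⟨p, hp⟩ := hne
  set e := chartAt (EuclideanSpace ℝ (Fin d)) p
  have he : e ∈ atlas (EuclideanSpace ℝ (Fin d)) M := chart_mem_atlas _ p
  have hps : p ∈ e.source := mem_chart_source _ p
  have hpt : e p ∈ e.target := e.map_source hps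
  have hA : IsOpen (U ∩ e.source) := hU.inter e.open_source
  refine lt_of_lt_of_le ?_ (measure_mono (inter_subset_left : U ∩ e.source ⊆ U))
  rw [S.volumeMeasure_apply he hA.measurableSet inter_subset_right,
    (S.chartVolume_apply e hA.measurableSet).1]
  set f : EuclideanSpace ℝ (Fin d) → ℝ := fun y ↦ √|(S.coordMatrix e y).det| with hf
  have hfc : ContinuousAt f (e p) := by
    have h1 : Continuous fun A : Matrix (Fin d) (Fin d) ℝ ↦ √|A.det| :=
      (continuous_id.matrix_det).abs.sqrt
    exact h1.continuousAt.comp (S.continuousAt_coordMatrix he hpt)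
  have hf0 : 0 < f (e p) := Real.sqrt_pos.2 (abs_pos.2 (S.det_coordMatrix_ne_zero he hpt))
  have h2 : ∀ᶠ y in 𝓝 (e p), f (e p) / 2 < f y :=
    continuousAt_const.eventually_lt hfc (half_lt_self hf0)
  have h3 : ∀ᶠ y in 𝓝 (e p), y ∈ e.symm ⁻¹' (U ∩ e.source) ∩ e.target := by
    refine inter_mem ((e.continuousAt_symm hpt).preimage_mem_nhds ?_) (e.open_target.mem_nhds hpt)
    rw [e.left_inv hps]
    exact hA.mem_nhds ⟨hp, hps⟩
  obtain ⟨N, hN, hNo, hpN⟩ := mem_nhds_iff.1 (h2.and h3)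
  calc (0 : ℝ≥0∞) < ENNReal.ofReal (f (e p) / 2) * volume N :=
        ENNReal.mul_pos (by simpa using hf0) (hNo.measure_pos volume ⟨_, hpN⟩).ne'
    _ = ∫⁻ _ in N, ENNReal.ofReal (f (e p) / 2) := by simp
    _ ≤ ∫⁻ y in N, S.chartDensity e y := by
        refine setLIntegral_mono' hNo.measurableSet fun y hy ↦ ?_
        exact ENNReal.ofReal_le_ofReal (hN hy).1.le
    _ ≤ _ := lintegral_mono_set fun y hy ↦ (hN hy).2

/-- A measurable set without chronologically related points is a null set. -/
lemma volumeMeasure_eq_zero_of_achronal [SecondCountableTopology M] (S : Spacetime d M) {N : Set M}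
    (hN : MeasurableSet N) (h : ∀ x ∈ N, ∀ y ∈ N, ¬ S.Chron x y) : S.volumeMeasure N = 0 := by
  refine measure_null_of_locally_null N fun p hp ↦ ?_
  obtain ⟨v, ρ, hρ, hsub, hv⟩ := exists_displacement S p
  set e := chartAt (EuclideanSpace ℝ (Fin d)) p
  have he : e ∈ atlas (EuclideanSpace ℝ (Fin d)) M := chart_mem_atlas _ p
  have hps : p ∈ e.source := mem_chart_source _ p
  set V := e.source ∩ e ⁻¹' Metric.ball (e p) (ρ / 2) with hV
  have hVo : IsOpen V := e.isOpen_inter_preimage Metric.isOpen_ball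
  refine ⟨N ∩ V, inter_mem_nhdsWithin N (hVo.mem_nhds ⟨hps, Metric.mem_ball_self (by positivity)⟩),
    ?_⟩
  have hm : MeasurableSet (N ∩ V) := hN.inter hVo.measurableSet
  obtain ⟨h1, h2⟩ := S.chartVolume_apply e hm
  rw [S.volumeMeasure_apply he hm (inter_subset_right.trans inter_subset_left), h1]
  refine setLIntegral_measure_zero _ _ ?_
  set X := e.symm ⁻¹' (N ∩ V) ∩ e.target with hX
  have hXb : X ⊆ Metric.ball (e p) (ρ / 2) := by
    rintro y ⟨hy, hyt⟩
    have := hy.2.2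
    rwa [mem_preimage, e.right_inv hyt] at this
  have hn0 : 0 < 2 * (‖v‖ + 1) := by positivity
  set δ := ρ / (2 * (‖v‖ + 1)) with hδ
  have hδ0 : 0 < δ := by positivity
  have hδv : δ * ‖v‖ < ρ / 2 := by
    have : δ * (2 * (‖v‖ + 1)) = ρ := by rw [hδ]; field_simp
    nlinarith
  -- Distinct shifts with differences at most `δ`. If two translates of `X` met, two points of `X`
  -- would differ by a positive multiple of the time direction and so be chronologically related.
  set s : ℕ → ℝ := fun n ↦ δ / (n + 1) with hs
  have hs1 : ∀ n m, n < m → 0 < s n - s m ∧ s n - s m ≤ δ := by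
    intro n m hnm
    have h3 : s m < s n := by
      simp only [hs]
      have : (n : ℝ) < m := by exact_mod_cast hnm
      gcongr
    have h4 : s n ≤ δ := div_le_self hδ0.le (by linarith [(Nat.cast_nonneg n : (0 : ℝ) ≤ n)])
    have h5 : 0 ≤ s m := by positivity
    constructor <;> linarith
  have key : ∀ n m, n < m → ∀ a ∈ X, ∀ b ∈ X, s n • v + a ≠ s m • v + b := by
    intro n m hnm a ha b hb hab
    have h3 : b = a + (s n - s m) • v := by
      have : s n • v + a - s m • v = b := by rw [hab]; abel
      rw [← this]
      module
    obtain ⟨h4, h5⟩ := hs1 n m hnm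
    have h6 := hv a (Metric.ball_subset_ball (by linarith) (hXb ha)) (s n - s m) h4
      (h3 ▸ Metric.ball_subset_ball (by linarith) (hXb hb))
    rw [← h3] at h6
    exact h _ ha.1.1 _ hb.1.1 h6
  -- Infinitely many disjoint translates by a bounded family of vectors fit into bounded space only
  -- if the set is null.
  refine Measure.addHaar_eq_zero_of_disjoint_translates volume (fun n ↦ s n • v)
    ?_ ?_ h2
  · refine (Metric.isBounded_closedBall (x := (0 : EuclideanSpace ℝ (Fin d)))
      (r := δ * ‖v‖)).subset ?_
    rintro _ ⟨n, rfl⟩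
    rw [mem_closedBall_zero_iff, norm_smul, Real.norm_eq_abs, abs_of_nonneg (by positivity)]
    have : s n ≤ δ := div_le_self hδ0.le (by linarith [(Nat.cast_nonneg n : (0 : ℝ) ≤ n)])
    gcongr
  · intro n m hnm
    refine Set.disjoint_left.2 ?_
    rintro _ ⟨_, rfl, a, ha, rfl⟩ ⟨_, rfl, b, hb, hab⟩
    rcases lt_or_gt_of_ne hnm with hlt | hlt
    · exact key n m hlt a ha b hb hab.symm
    · exact key m n hlt b hb a ha hab

lemma cosmologicalVolume_pos (S : Spacetime d M) (x : M) : 0 < S.cosmologicalVolume x :=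
  S.volumeMeasure_pos_of_isOpen (isOpen_chronologicalPast S x) <| by
    obtain ⟨q, -, hq⟩ := exists_chron_left_mem S (p := x) univ_mem
    exact ⟨q, hq⟩

end Volume

/-! ### Consequences of regularity: causality, monotonicity and continuity -/

section Global

variable {d : ℕ} {M : Type*} [TopologicalSpace M]
  [ChartedSpace (EuclideanSpace ℝ (Fin d)) M] [IsManifold (𝓡 d) ∞ M]
  {S : Spacetime d M} {p q r x y z : M} {γ : ℝ → M} {a b : ℝ}

/-- A constant curve has zero velocity, which is not causal. -/
lemma PiecewiseArc.exists_ne (h : PiecewiseArc S.FutureCausal γ a b) :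
    ∃ t ∈ Icc a b, γ t ≠ γ a := by
  by_contra! hcon
  obtain ⟨t, ht, h1⟩ := h.exists_first_arc
  have h2 : IsArc S.FutureCausal (fun _ ↦ γ a) a t :=
    h1.congr fun u hu ↦ (hcon u ⟨hu.1, hu.2.trans ht.2⟩).symm
  refine (h2.2 a (left_mem_Icc.2 ht.1.le)).1 ?_
  rw [mfderivWithin_const]
  rfl

lemma PiecewiseArc.strictlyCausal (h : PiecewiseArc S.FutureCausal γ a b) :
    S.StrictlyCausal (γ a) (γ b) :=
  ⟨γ, a, b, h.lt, h.isPiecewiseCurve, rfl, rfl⟩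

/-- Sampling a single timelike curve ending at `x` makes the terms chronologically increasing, so
their pasts increase too, as continuity of measure from below requires. -/
lemma exists_seq_chron_left (S : Spacetime d M) (x : M) : ∃ u : ℕ → M,
    (∀ n, S.Chron (u n) (u (n + 1))) ∧ (∀ n, S.Chron (u n) x) ∧ Tendsto u atTop (𝓝 x) := by
  obtain ⟨q, -, hq⟩ := exists_chron_left_mem S (p := x) univ_mem
  obtain ⟨γ, hγ, -, rfl, -⟩ := hq.exists_piecewiseArc (a := -2) (b := 0) (by norm_num)
  have hpos : ∀ n : ℕ, 0 < 1 / ((n : ℝ) + 1) := fun n ↦ by positivity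
  have hle : ∀ n : ℕ, 1 / ((n : ℝ) + 1) ≤ 1 := fun n ↦
    div_le_one_of_le₀ (by linarith [(Nat.cast_nonneg n : (0 : ℝ) ≤ n)]) (by positivity)
  refine ⟨fun n ↦ γ (-(1 / ((n : ℝ) + 1))), fun n ↦ (hγ.mono ?_ ?_ ?_).chron,
    fun n ↦ (hγ.mono ?_ ?_ ?_).chron, ?_⟩
  · linarith [hle n]
  · push_cast
    have : 1 / ((n : ℝ) + 1 + 1) < 1 / ((n : ℝ) + 1) :=
      one_div_lt_one_div_of_lt (by positivity) (by linarith)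
    linarith
  · have := hpos (n + 1)
    linarith
  · linarith [hle n]
  · linarith [hpos n]
  · exact le_rfl
  · have h1 : Tendsto (fun n : ℕ ↦ -(1 / ((n : ℝ) + 1))) atTop (𝓝[Icc (-2) 0] 0) := by
      refine tendsto_nhdsWithin_iff.2 ⟨?_, Eventually.of_forall fun n ↦ ⟨?_, ?_⟩⟩
      · have := (tendsto_one_div_add_atTop_nhds_zero_nat (𝕜 := ℝ)).neg
        rwa [neg_zero] at this
      · linarith [hle n]
      · linarith [hpos n]
    exact (hγ.continuousOn 0 (by simp)).tendsto.comp h1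

lemma exists_seq_chron_right (S : Spacetime d M) (x : M) : ∃ u : ℕ → M,
    (∀ n, S.Chron (u (n + 1)) (u n)) ∧ (∀ n, S.Chron x (u n)) ∧ Tendsto u atTop (𝓝 x) := by
  obtain ⟨q, -, hq⟩ := exists_chron_right_mem S (p := x) univ_mem
  obtain ⟨γ, hγ, rfl, -, -⟩ := hq.exists_piecewiseArc (a := 0) (b := 2) (by norm_num)
  have hpos : ∀ n : ℕ, 0 < 1 / ((n : ℝ) + 1) := fun n ↦ by positivity
  have hle : ∀ n : ℕ, 1 / ((n : ℝ) + 1) ≤ 1 := fun n ↦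
    div_le_one_of_le₀ (by linarith [(Nat.cast_nonneg n : (0 : ℝ) ≤ n)]) (by positivity)
  refine ⟨fun n ↦ γ (1 / ((n : ℝ) + 1)), fun n ↦ (hγ.mono ?_ ?_ ?_).chron,
    fun n ↦ (hγ.mono ?_ ?_ ?_).chron, ?_⟩
  · exact (hpos (n + 1)).le
  · push_cast
    exact one_div_lt_one_div_of_lt (by positivity) (by linarith)
  · linarith [hle n]
  · exact le_rfl
  · exact hpos n
  · linarith [hle n]
  · have h1 : Tendsto (fun n : ℕ ↦ 1 / ((n : ℝ) + 1)) atTop (𝓝[Icc 0 2] 0) := by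
      refine tendsto_nhdsWithin_iff.2 ⟨tendsto_one_div_add_atTop_nhds_zero_nat,
        Eventually.of_forall fun n ↦ ⟨(hpos n).le, ?_⟩⟩
      linarith [hle n]
    exact (hγ.continuousOn 0 (by simp)).tendsto.comp h1

variable [MeasurableSpace M] [BorelSpace M]

namespace HasRegularCosmologicalVolume

section Metrizable

variable [TopologicalSpace.MetrizableSpace M]

/-- A causally decreasing sequence whose chronological futures have a common lower bound
converges. -/
lemma exists_tendsto (hS : S.HasRegularCosmologicalVolume) {q : ℕ → M}
    (hq : ∀ n, S.CausalLE (q (n + 1)) (q n)) {a : M}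
    (ha : ∀ n w, S.Chron (q n) w → S.Chron a w) : ∃ p, Tendsto q atTop (𝓝 p) := by
  let _ := TopologicalSpace.metrizableSpaceMetric M
  by_contra! hlim
  -- The sequence is only causally decreasing. Moving each term slightly into its future makes it
  -- chronologically decreasing without changing its convergence, since the shifts tend to zero.
  have hstep : ∀ (n : ℕ) (w : M), S.Chron (q n) w → ∃ w', S.Chron (q (n + 1)) w' ∧ S.Chron w' w ∧
      dist w' (q (n + 1)) < 1 / ((n + 1 : ℕ) + 1 : ℝ) := by
    intro n w hw
    have h1 : S.Chron (q (n + 1)) w := (hq n).2 w hw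
    have h2 : {w' | S.Chron w' w} ∩ Metric.ball (q (n + 1)) (1 / ((n + 1 : ℕ) + 1 : ℝ)) ∈
        𝓝 (q (n + 1)) :=
      inter_mem h1.eventually_left (Metric.ball_mem_nhds _ (by positivity))
    obtain ⟨w', h3, h4⟩ := exists_chron_right_mem S h2
    exact ⟨w', h4, h3.1, h3.2⟩
  choose f hf1 hf2 hf3 using hstep
  obtain ⟨w₀, hw₀, hw₀'⟩ := exists_chron_right_mem S (Metric.ball_mem_nhds (q 0) one_pos)
  let W : ∀ n, {w // S.Chron (q n) w} :=
    fun n ↦ Nat.rec ⟨w₀, hw₀'⟩ (fun n w ↦ ⟨f n w.1 w.2, hf1 n w.1 w.2⟩) n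
  set w : ℕ → M := fun n ↦ (W n).1 with hw
  have hdist : ∀ n, dist (w n) (q n) < 1 / ((n : ℝ) + 1) := by
    rintro (_ | n)
    · simpa [hw, W] using hw₀
    · exact_mod_cast hf3 n (W n).1 (W n).2
  have hwlim : ∀ p, ¬ Tendsto w atTop (𝓝 p) := by
    intro p hp
    refine hlim p ?_
    have h1 : Tendsto (fun n ↦ dist (w n) (q n)) atTop (𝓝 0) :=
      squeeze_zero (fun _ ↦ dist_nonneg) (fun n ↦ (hdist n).le)
        tendsto_one_div_add_atTop_nhds_zero_nat
    exact (tendsto_iff_of_dist h1).1 hp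
  obtain ⟨γ, hγ, hγi, hγw⟩ := exists_pastInextendible_of_seq (S := S) (w := w)
    (fun n ↦ hf2 n (W n).1 (W n).2) hwlim
  have h1 := hS.tendsto_zero γ (Iic 0) (isPiecewiseCurve_iff.2
    ⟨ordConnected_Iic, hγ.2.1, fun a ha b hb hab ↦
      (hγ.piecewiseArc ha hb hab).imp fun _ _ h ↦ h.futureCausal⟩) hγi
  have h2 : ∀ᶠ t : Iic (0 : ℝ) in atBot, S.cosmologicalVolume (γ t) < S.cosmologicalVolume a :=
    h1.eventually_lt_const (S.cosmologicalVolume_pos a)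
  obtain ⟨t, ht⟩ := eventually_atBot.1 h2
  obtain ⟨n, hn⟩ := exists_nat_gt (-(t : ℝ))
  have h3 := ht ⟨-n, by simp⟩ (Subtype.coe_le_coe.1 (by simp only; linarith))
  rw [hγw n] at h3
  -- All pasts along the shadowing sequence contain `I⁻(a)`, so `τ` cannot fall below `τ(a)`.
  exact h3.not_ge (cosmologicalVolume_mono fun b hb ↦
    hb.trans (ha n _ (W n).2))

/-- If `z` did not precede `x`, `exists_limit_step` could be iterated greedily into a decreasing
sequence without limit. Any `a ≪ z` lies below all futures of its terms, which contradicts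
`exists_tendsto`. -/
lemma causalLE_of_mem_closure (hS : S.HasRegularCosmologicalVolume)
    (h : (z, x) ∈ closure {a : M × M | S.Chron a.1 a.2}) : S.CausalLE z x := by
  by_contra hn
  obtain ⟨q, -, hP, hR, hlim⟩ := exists_seq_forall_not_tendsto
    (R := fun q r ↦ S.CausalLE r q)
    (P := fun q ↦ (z, q) ∈ closure {a : M × M | S.Chron a.1 a.2} ∧ ¬ S.CausalLE z q) ⟨h, hn⟩ <| by
      intro p
      obtain ⟨C, hC, hpC, hstep⟩ := exists_limit_step S z p
      refine ⟨C, hC, hpC, hstep.mono fun q hq hPq ↦ ?_⟩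
      obtain ⟨r, h1, h2, h3⟩ := (hq hPq.1).resolve_left hPq.2
      exact ⟨r, h1, h2, h3, fun h4 ↦ hPq.2 (h4.trans h2)⟩
  obtain ⟨a, -, ha⟩ := exists_chron_left_mem S (p := z) univ_mem
  obtain ⟨p, hp⟩ := hS.exists_tendsto hR (a := a) fun n w hw ↦ by
    have h1 : ∀ᶠ b : M × M in 𝓝 (z, q n), S.Chron a b.1 ∧ S.Chron b.2 w :=
      (continuousAt_fst (p := (z, q n)) |>.eventually ha.eventually_right).and
        (continuousAt_snd (p := (z, q n)) |>.eventually hw.eventually_left)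
    obtain ⟨b, h2, h3, h4⟩ :=
      ((mem_closure_iff_frequently.1 (hP n).1).and_eventually h1).exists
    exact (h3.trans h2).trans h4
  exact hlim p hp

/-- The alternating sequence `x, y, x, y, …` is causally decreasing and bounded below, hence
convergent. -/
lemma causalLE_antisymm (hS : S.HasRegularCosmologicalVolume) (hxy : S.CausalLE x y)
    (hyx : S.CausalLE y x) : x = y := by
  obtain ⟨a, -, ha⟩ := exists_chron_left_mem S (p := x) univ_mem
  set q : ℕ → M := fun n ↦ if Even n then x else y with hq
  obtain ⟨p, hp⟩ := hS.exists_tendsto (q := q) (a := a)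
    (fun n ↦ by by_cases hn : Even n <;> simp [hq, hn, Nat.even_add_one, hxy, hyx])
    (fun n w hw ↦ by
      by_cases hn : Even n
      · simp only [hq, hn, if_true] at hw
        exact ha.trans hw
      · simp only [hq, hn, if_false] at hw
        exact (hxy.1 a ha).trans hw)
  have h1 : Tendsto (fun n : ℕ ↦ 2 * n) atTop atTop := tendsto_id.const_mul_atTop' two_pos
  have h2 : Tendsto (fun n : ℕ ↦ 2 * n + 1) atTop atTop := (tendsto_add_atTop_nat 1).comp h1
  have h3 : Tendsto (fun _ : ℕ ↦ x) atTop (𝓝 p) := (hp.comp h1).congr fun n ↦ by simp [hq]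
  have h4 : Tendsto (fun _ : ℕ ↦ y) atTop (𝓝 p) := (hp.comp h2).congr fun n ↦ by simp [hq]
  rw [tendsto_const_nhds_iff] at h3 h4
  rw [h3, h4]

lemma not_strictlyCausal_self (hS : S.HasRegularCosmologicalVolume) (x : M) :
    ¬ S.StrictlyCausal x x := by
  rintro ⟨γ, a, b, hab, hγ, ha, hb⟩
  have h := hγ.piecewiseArc (left_mem_Icc.2 hab.le) (right_mem_Icc.2 hab.le) hab
  obtain ⟨t, ht, hne⟩ := h.exists_ne
  have hat : a < t := lt_of_le_of_ne ht.1 fun h ↦ hne (by rw [h])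
  have htb : t < b := lt_of_le_of_ne ht.2 fun h ↦ hne (by rw [h, hb, ha])
  refine hne (hS.causalLE_antisymm ?_ (h.mono le_rfl hat htb.le).causalLE)
  have := (h.mono hat.le htb le_rfl).causalLE
  rwa [hb, ← ha] at this

/-- If the volumes agreed, `I⁻(y) \ I⁻(x)` would be null by finiteness, so `I⁻(x)` would be dense in
the open set `I⁻(y)`. Points just before `y` could then be approximated from `I⁻(x)`, making `(y,
x)` a limit of chronological pairs. -/
lemma cosmologicalVolume_lt (hS : S.HasRegularCosmologicalVolume) (h : S.StrictlyCausal x y) :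
    S.cosmologicalVolume x < S.cosmologicalVolume y := by
  by_contra! hle
  have hxy := h.causalLE
  have hsub : S.chronologicalPast x ⊆ S.chronologicalPast y := fun a ha ↦ hxy.1 a ha
  have hnull : S.volumeMeasure (S.chronologicalPast y \ S.chronologicalPast x) = 0 := by
    rw [measure_sdiff hsub (isOpen_chronologicalPast S x).measurableSet.nullMeasurableSet
      (hS.finite x).ne]
    exact tsub_eq_zero_of_le hle
  have hcl : S.chronologicalPast y ⊆ closure (S.chronologicalPast x) := by
    by_contra hcon
    obtain ⟨a, ha, ha'⟩ := not_subset.1 hcon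
    have h1 : IsOpen (S.chronologicalPast y \ closure (S.chronologicalPast x)) :=
      (isOpen_chronologicalPast S y).sdiff isClosed_closure
    refine (S.volumeMeasure_pos_of_isOpen h1 ⟨a, ha, ha'⟩).ne' (measure_mono_null ?_ hnull)
    exact sdiff_subset_sdiff_right subset_closure
  have hmem : (y, x) ∈ closure {a : M × M | S.Chron a.1 a.2} := by
    refine mem_closure_iff_nhds.2 fun t ht ↦ ?_
    obtain ⟨u, hu, v, hv, huv⟩ := mem_nhds_prod_iff.1 ht
    obtain ⟨y', hy', hy''⟩ := exists_chron_left_mem S (interior_mem_nhds.2 hu)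
    obtain ⟨y₁, h1, h2⟩ := mem_closure_iff.1 (hcl hy'') _ isOpen_interior hy'
    exact ⟨(y₁, x), huv ⟨interior_subset h1, mem_of_mem_nhds hv⟩, h2⟩
  have heq := hS.causalLE_antisymm hxy (hS.causalLE_of_mem_closure hmem)
  subst heq
  exact hS.not_strictlyCausal_self x h

/-- Any point `r ≪ p` is a possible next step from all points near `p`, and `r ≠ p` because there
are no closed causal curves. The greedy sequence of such steps therefore has no limit. -/
lemma exists_pastInextendible (hS : S.HasRegularCosmologicalVolume) (x : M) :
    ∃ γ : ℝ → M, S.IsCausalCurve γ (Iic 0) ∧ PastInextendible γ (Iic 0) ∧ γ 0 = x := by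
  obtain ⟨q, hq0, -, hR, hlim⟩ := exists_seq_forall_not_tendsto
    (R := fun q r ↦ S.Chron r q) (P := fun _ ↦ True) (x := x) trivial <| by
      intro p
      obtain ⟨r, -, hr⟩ := exists_chron_left_mem S (p := p) univ_mem
      refine ⟨{r}, isClosed_singleton, ?_, hr.eventually_right.mono fun q hq _ ↦
        ⟨r, rfl, hq, trivial⟩⟩
      rintro rfl
      exact hS.not_strictlyCausal_self _ hr.strictlyCausal
  obtain ⟨γ, hγ, hγi, hγq⟩ := exists_pastInextendible_of_seq hR hlim
  refine ⟨γ, isPiecewiseCurve_iff.2 ⟨ordConnected_Iic, hγ.2.1, fun a ha b hb hab ↦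
      (hγ.piecewiseArc ha hb hab).imp fun _ _ h ↦ h.futureCausal⟩, hγi, ?_⟩
  simpa [hq0] using hγq 0

/-- From below, `I⁻(x)` is the increasing union of the pasts of `u n ≪ x`. From above, the
intersection of the pasts of `u n ≫ x` exceeds `I⁻(x)` only by an achronal set: for `a ≪ b` with `b`
in the intersection, closedness gives `b ≤ x` and hence `a ≪ x`. -/
lemma continuous_cosmologicalVolume [SecondCountableTopology M]
    (hS : S.HasRegularCosmologicalVolume) : Continuous S.cosmologicalVolume := by
  refine continuous_iff_continuousAt.2 fun x ↦ tendsto_order.2 ⟨fun c hc ↦ ?_, fun c hc ↦ ?_⟩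
  · obtain ⟨u, hu, hux, hlim⟩ := exists_seq_chron_left S x
    have hmono : Monotone fun n ↦ S.chronologicalPast (u n) :=
      monotone_nat_of_le_succ fun n a ha ↦ ChronologicalIn.trans ha (hu n)
    have hunion : ⋃ n, S.chronologicalPast (u n) = S.chronologicalPast x := by
      refine subset_antisymm (iUnion_subset fun n a ha ↦ ChronologicalIn.trans ha (hux n))
        fun a ha ↦ ?_
      obtain ⟨n, hn⟩ := (hlim.eventually (Chron.eventually_right ha)).exists
      exact mem_iUnion.2 ⟨n, hn⟩
    have h1 := tendsto_measure_iUnion_atTop (μ := S.volumeMeasure) hmono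
    rw [hunion] at h1
    obtain ⟨n, hn⟩ := (h1.eventually (lt_mem_nhds hc)).exists
    filter_upwards [(hux n).eventually_right] with y hy
    exact lt_of_lt_of_le hn (cosmologicalVolume_mono fun a ha ↦ ha.trans hy)
  · obtain ⟨u, hu, hux, hlim⟩ := exists_seq_chron_right S x
    have hanti : Antitone fun n ↦ S.chronologicalPast (u n) :=
      antitone_nat_of_succ_le fun n a ha ↦ ChronologicalIn.trans ha (hu n)
    have hm : ∀ y, MeasurableSet (S.chronologicalPast y) := fun y ↦
      (isOpen_chronologicalPast S y).measurableSet
    have h1 := tendsto_measure_iInter_atTop (μ := S.volumeMeasure)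
      (fun n ↦ (hm (u n)).nullMeasurableSet) hanti ⟨0, (hS.finite (u 0)).ne⟩
    have hnull : S.volumeMeasure ((⋂ n, S.chronologicalPast (u n)) \ S.chronologicalPast x) = 0 := by
      refine S.volumeMeasure_eq_zero_of_achronal ((MeasurableSet.iInter fun n ↦ hm _).diff (hm x)) ?_
      rintro a ⟨-, ha⟩ b ⟨hb, -⟩ hab
      refine ha ((hS.causalLE_of_mem_closure (z := b) ?_).1 a hab)
      exact mem_closure_of_tendsto ((tendsto_const_nhds (x := b)).prodMk_nhds hlim)
        (Eventually.of_forall fun n ↦ mem_iInter.1 hb n)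
    have hle : S.volumeMeasure (⋂ n, S.chronologicalPast (u n)) ≤ S.cosmologicalVolume x := by
      refine (measure_le_inter_add_sdiff _ _ (S.chronologicalPast x)).trans ?_
      rw [hnull, add_zero]
      exact measure_mono inter_subset_right
    obtain ⟨n, hn⟩ := (h1.eventually (gt_mem_nhds (hle.trans_lt hc))).exists
    filter_upwards [(hux n).eventually_left] with y hy
    exact lt_of_le_of_lt (cosmologicalVolume_mono fun a ha ↦ ha.trans hy) hn

lemma isTimeFunction [SecondCountableTopology M] (hS : S.HasRegularCosmologicalVolume) :
    S.IsTimeFunction fun x ↦ (S.cosmologicalVolume x).toReal := by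
  refine ⟨continuous_iff_continuousAt.2 fun x ↦
    (ENNReal.tendsto_toReal (hS.finite x).ne).comp
      hS.continuous_cosmologicalVolume.continuousAt, fun γ s hγ u hu v hv huv ↦ ?_⟩
  exact ENNReal.toReal_strict_mono (hS.finite _).ne
    (hS.cosmologicalVolume_lt (hγ.piecewiseArc hu hv huv).strictlyCausal)

end Metrizable

end HasRegularCosmologicalVolume

end Global

/-! ### Level sets of time functions -/

section LevelSets

variable {d : ℕ} {M : Type*} [TopologicalSpace M]
  [ChartedSpace (EuclideanSpace ℝ (Fin d)) M] [IsManifold (𝓡 d) ∞ M]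
  {S : Spacetime d M} {x y : M} {γ : ℝ → M} {s : Set ℝ} {f : M → ℝ} {t : ℝ}

lemma IsTimeFunction.lt_of_strictlyCausal (hf : S.IsTimeFunction f) (h : S.StrictlyCausal x y) :
    f x < f y := by
  obtain ⟨γ, a, b, hab, hγ, rfl, rfl⟩ := h
  exact hf.2 γ _ hγ (left_mem_Icc.2 hab.le) (right_mem_Icc.2 hab.le) hab

lemma IsTimeFunction.edge_level_eq_empty (hf : S.IsTimeFunction f) (t : ℝ) :
    S.edge {x | f x = t} = ∅ := by
  refine eq_empty_of_forall_notMem fun p hp ↦ ?_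
  have hpt : f p = t := by
    have : IsClosed {x | f x = t} := isClosed_eq hf.1 continuous_const
    have h1 := hp.1
    rwa [this.closure_eq] at h1
  -- The trivial neighbourhood suffices: any timelike curve from a value below `t` to one above it
  -- must meet the level set.
  obtain ⟨x, y, hxp, hpy, γ, a, b, hab, hγ, rfl, rfl, hU⟩ := hp.2 univ univ_mem
  have h1 := hf.lt_of_strictlyCausal hxp.strictlyCausal
  have h2 := hf.lt_of_strictlyCausal hpy.strictlyCausal
  obtain ⟨u, hu, hut⟩ := IsPiecewiseCurve.exists_eq hγ hf.1 (left_mem_Icc.2 hab.le)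
    (right_mem_Icc.2 hab.le) hab.le (h1.le.trans_eq hpt) (hpt.symm.le.trans h2.le)
  exact (hU u hu).2 hut

variable [MeasurableSpace M]

namespace HasRegularCosmologicalVolume

lemma exists_toReal_lt (hS : S.HasRegularCosmologicalVolume) (hγ : S.IsCausalCurve γ s)
    (hi : PastInextendible γ s) (ht : 0 < t) :
    ∃ u ∈ s, ∀ v ∈ s, v ≤ u → (S.cosmologicalVolume (γ v)).toReal < t := by
  have : Nonempty s := hγ.2.1.nonempty.to_subtype
  obtain ⟨u, hu⟩ := eventually_atBot.1 ((hS.tendsto_zero γ s hγ hi).eventually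
    (gt_mem_nhds (ENNReal.ofReal_pos.2 ht)))
  exact ⟨u, u.2, fun v hv hvu ↦ ENNReal.toReal_lt_of_lt_ofReal (hu ⟨v, hv⟩ hvu)⟩

variable [BorelSpace M] [TopologicalSpace.MetrizableSpace M] [SecondCountableTopology M]

/-- That `D⁺` lies in `J⁺` requires some past-inextendible curve ending at each point, since
otherwise membership in `D⁺` could be vacuous. Conversely, `τ` is at least `t` on `J⁺` and tends to
`0` in the past, so it passes through `t`. -/
lemma isFutureCauchySurface (hS : S.HasRegularCosmologicalVolume) (ht : 0 < t) :
    S.IsFutureCauchySurface {x | (S.cosmologicalVolume x).toReal = t} := by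
  have hf := hS.isTimeFunction
  refine ⟨isClosed_eq hf.1 continuous_const, fun x hx y hy hxy ↦ ?_, hf.edge_level_eq_empty t, ?_⟩
  · exact (hf.lt_of_strictlyCausal hxy).ne (hx.trans hy.symm)
  refine subset_antisymm (fun x hx ↦ ?_) ?_
  · obtain ⟨γ, hγ, hγi, rfl⟩ := hS.exists_pastInextendible x
    obtain ⟨u, hu, hut⟩ := hx γ (Iic 0) 0 hγ hγi isGreatest_Iic rfl
    refine ⟨γ u, hut, ?_⟩
    rcases (mem_Iic.1 hu).eq_or_lt with rfl | hlt
    · exact Or.inl rfl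
    · exact Or.inr (hγ.piecewiseArc hu (mem_Iic.2 le_rfl) hlt).strictlyCausal
  · rintro x ⟨y, hy, hyx⟩ γ s b hγ hγi hb rfl
    have hle : t ≤ (S.cosmologicalVolume (γ b)).toReal := by
      rcases hyx with rfl | hlt
      · exact hy.ge
      · exact hy.symm.le.trans (hf.lt_of_strictlyCausal hlt).le
    obtain ⟨u, hu, hut⟩ := hS.exists_toReal_lt hγ hγi ht
    obtain ⟨v, hv, hvt⟩ := IsPiecewiseCurve.exists_eq hγ hf.1 hu hb.1 (hb.2 hu)
      (hut u hu le_rfl).le hle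
    exact ⟨v, hγ.1.out hu hb.1 hv, hvt⟩

/-- Along an inextendible curve `τ` runs from `0` to `∞`; continuity gives a crossing and strict
monotonicity makes it unique. -/
lemma isCauchySurface (hS : S.HasRegularCosmologicalVolume)
    (htop : ∀ (γ : ℝ → M) (s : Set ℝ), S.IsCausalCurve γ s → Inextendible γ s →
      Tendsto (fun u : s ↦ S.cosmologicalVolume (γ u)) atTop (𝓝 ⊤)) (ht : 0 < t) :
    S.IsCauchySurface {x | (S.cosmologicalVolume x).toReal = t} := by
  intro γ s hγ hi
  have hf := hS.isTimeFunction
  have : Nonempty s := hγ.2.1.nonempty.to_subtype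
  obtain ⟨u, hu, hut⟩ := hS.exists_toReal_lt hγ hi.1 ht
  obtain ⟨v, hv⟩ := eventually_atTop.1 ((htop γ s hγ hi).eventually
    (lt_mem_nhds (ENNReal.ofReal_lt_top (r := t))))
  have hm : max u v ∈ s := by
    rcases max_choice u v with h | h <;> rw [h]
    exacts [hu, v.2]
  have h1 : t ≤ (S.cosmologicalVolume (γ (max u v))).toReal :=
    (ENNReal.ofReal_le_iff_le_toReal (hS.finite _).ne).1 (hv ⟨_, hm⟩ (le_max_right u v)).le
  obtain ⟨w, hw, hwt⟩ := IsPiecewiseCurve.exists_eq hγ hf.1 hu hm (le_max_left _ _)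
    (hut u hu le_rfl).le h1
  refine ⟨w, ⟨hγ.1.out hu hm hw, hwt⟩, fun w' hw' ↦ ?_⟩
  exact (hf.2 γ s hγ).injOn hw'.1 (hγ.1.out hu hm hw) (hw'.2.trans hwt.symm)

end HasRegularCosmologicalVolume

end LevelSets

end Spacetime

end

theorem mainTheorem4 {d : ℕ} {M : Type*} [TopologicalSpace M] [T2Space M]
    [SecondCountableTopology M] [ConnectedSpace M]
    [ChartedSpace (EuclideanSpace ℝ (Fin d)) M] [IsManifold (𝓡 d) ∞ M]
    [MeasurableSpace M] [BorelSpace M]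
    (S : Spacetime d M) (hS : S.HasRegularCosmologicalVolume) :
    S.IsTimeFunction (fun x ↦ (S.cosmologicalVolume x).toReal) ∧
    (∀ t : ℝ, 0 < t → S.IsFutureCauchySurface {x | (S.cosmologicalVolume x).toReal = t}) ∧
    ((∀ (γ : ℝ → M) (s : Set ℝ), S.IsCausalCurve γ s → Spacetime.Inextendible γ s →
        Tendsto (fun u : s ↦ S.cosmologicalVolume (γ u)) atTop (𝓝 ⊤)) →
      ∀ t : ℝ, 0 < t → S.IsCauchySurface {x | (S.cosmologicalVolume x).toReal = t}) := by
  -- Local compactness serves to make the manifold metrizable, as the greedy and shadowing sequences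
  -- measure their steps by a metric.
  have := ChartedSpace.locallyCompactSpace (EuclideanSpace ℝ (Fin d)) M
  have := Manifold.metrizableSpace (𝓡 d) M
  exact ⟨hS.isTimeFunction, fun t ht ↦ hS.isFutureCauchySurface ht,
    fun htop t ht ↦ hS.isCauchySurface htop ht⟩
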